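/- All topological groups below are Polish, i.e. separable and completely metrizable. A Polish group is *TSI* if its topology is induced by a two-sided invariant metric. It is *pro-Lie* if every open neighbourhood of its identity contains a closed normal subgroup $N$ such that the quotient by $N$ is a (finite-dimensional real, possibly disconnected) Lie group. It is *non-archimedean* if its identity has a neighbourhood base of open subgroups. For a Polish group $G$ let $G_0$ be the connected component of the identity, let $\mathrm{Inn}_G(G_0)$ be the set of all maps $\iota_u:G_0\to G_0$, $\iota_u(g)=ugu^{-1}$, with $u\in G$, and let $E(G)$ be the equivalence relation on $G^{\omega}$ given by $$x\,E(G)\,y\iff \big(x(n)y(n)^{-1}\big)_{n}\text{ converges in }G .$$ For equivalence relations $E$, $F$ on Polish spaces $X$, $Y$ write $E\leq_B F$ if there is a Borel map $\theta:X\to Y$ such that $x\,E\,x'\iff\theta(x)\,F\,\theta(x')$ for all $x,x'\in X$. **Theorem.** Let $G$ be a TSI Polish group such that $G_0$ is open in $G$, and let $H$ be a pro-Lie TSI Polish group. If $E(G)\leq_B E(H)$, then there is a continuous homomorphism $\phi:G_0\to H$, with $\phi(G_0)\subseteq H_0$, such that $\ker(\phi)$ is non-archimedean and $$\phi\,\mathrm{Inn}_G(G_0)\subseteq\overline{\mathrm{Inn}_H(H_0)\,\phi}$$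 in the topology of pointwise convergence on the maps $G_0\to H$; that is, for every $u\in G$ there is a sequence $(h_n)$ in $H$ such that $\phi(ugu^{-1})=\lim_n h_n\phi(g)h_n^{-1}$ for all $g\in G_0$. -/

import Mathlib

open Topology Filter
open scoped Manifold ContDiff

/-- A topological group is TSI if its topology is induced by a two-sided invariant metric. -/
def IsTSI (G : Type*) [Group G] [τ : TopologicalSpace G] : Prop :=
  ∃ m : MetricSpace G, m.toUniformSpace.toTopologicalSpace = τ ∧
    (∀ a b c : G, m.dist (c * a) (c * b) = m.dist a b) ∧
    (∀ a b c : G, m.dist (a * c) (b * c) = m.dist a b)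

/-- A topological group is a (real, finite-dimensional, possibly disconnected) Lie group if it
carries a smooth atlas compatible with its topology for which the operations are smooth. -/
def IsLie (G : Type*) [Group G] [TopologicalSpace G] : Prop :=
  T2Space G ∧ ∃ (n : ℕ) (_ : ChartedSpace (EuclideanSpace ℝ (Fin n)) G), LieGroup (𝓡 n) ∞ G

/-- The pro-Lie condition for a completely metrizable topological group: every open neighbourhood
of the identity contains a closed normal subgroup with Lie quotient. -/
def IsProLie (G : Type*) [Group G] [TopologicalSpace G] : Prop :=
  TopologicalSpace.IsCompletelyMetrizableSpace G ∧
    ∀ U : Set G, IsOpen U → (1 : G) ∈ U →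
      ∃ (N : Subgroup G) (_ : N.Normal), IsClosed (N : Set G) ∧ (N : Set G) ⊆ U ∧ IsLie (G ⧸ N)

/-- The equivalence relation `E(G)` on the sequence space of `G`: two sequences `x`, `y` are
equivalent iff `x(n) y(n)⁻¹` converges in `G`. -/
def seqEquiv (G : Type*) [Group G] [TopologicalSpace G] [IsTopologicalGroup G] :
    Setoid (ℕ → G) where
  r x y := ∃ l : G, Tendsto (fun n => x n * (y n)⁻¹) atTop (𝓝 l)
  iseqv :=
    { refl := fun x => ⟨1, by simpa using tendsto_const_nhds⟩
      symm := fun {x y} ⟨l, hl⟩ => ⟨l⁻¹, by simpa using hl.inv⟩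
      trans := fun {x y z} ⟨l, hl⟩ ⟨k, hk⟩ => ⟨l * k, by simpa [mul_assoc] using hl.mul hk⟩ }

/-- Borel reducibility `E ≤_B F` of equivalence relations on topological spaces. -/
def BorelReducible {X Y : Type*} [TopologicalSpace X] [TopologicalSpace Y]
    (E : Setoid X) (F : Setoid Y) : Prop :=
  ∃ θ : X → Y, @Measurable X Y (borel X) (borel Y) θ ∧ ∀ x y : X, E x y ↔ F (θ x) (θ y)

/-- The identity component of a topological group is a normal subgroup. -/
instance identityComponent_normal (G : Type*) [Group G] [TopologicalSpace G]
    [IsTopologicalGroup G] : (Subgroup.connectedComponentOfOne G).Normal where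
  conj_mem n hn g := by
    have hc : Continuous fun x : G => g * x * g⁻¹ := by fun_prop
    have h := hc.image_connectedComponent_subset 1 (Set.mem_image_of_mem _ hn)
    rw [mul_one, mul_inv_cancel] at h
    exact h

/-- `Inn_G(N)`: the self-maps `g ↦ u g u⁻¹` of a normal subgroup `N`, for `u` in `G`. -/
def innOn (G : Type*) [Group G] (N : Subgroup G) [N.Normal] : Set (N → N) :=
  Set.range fun u : G => fun g : N => MulAut.conjNormal u g

/-! Since `E(G)` is invariant under right translation, a Borel reduction `θ` may be replaced by `w ↦
θ (w * z)` with `z` generic for a countable dense subgroup `Γ`. The resulting `f` behaves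
continuously at the eventually constant `Γ`-valued sequences. For two such sequences `a`, `b` the
ratio `f a l * (f b l)⁻¹` converges; its limit `limRatio f a b` is a cocycle and hardly changes when
both sequences are multiplied on the right by the same element far out.

Two pasting arguments control these limits. If far-out sequences could be arbitrarily close to each
other and have images a fixed distance apart, pasting such pairs would give `u`, `v` with `u n * (v
n)⁻¹ → 1` but divergent image ratios; this is `exists_forall_dist_le`. In the second argument the
closeness `ρ` of the sequences stays fixed. If the limits of ratios stayed away from `N` for pairs
arbitrarily far out, independent choices in the successive blocks would realise all ordered products
of these limits, up to small errors, inside a neighbourhood without nontrivial cyclic subgroups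
modulo `N`. A cluster point of the limits would have all its powers in that neighbourhood, hence be
trivial modulo `N`; this is `exists_forall_infDist_le`.

An element of `Γ` in the identity component is a product of `ρ`-small elements of `Γ`. So a change
by it, or by conjugates of it, on a bounded block far out is negligible
(`exists_forall_dist_limRatio_le_of_conj`). Therefore only the value at infinity matters: `limRatio
f (tail n g) 1` converges to some `limHom f g`, which is multiplicative and uniformly continuous in
`g`. As the identity component is open, `Γ` is dense in it and `limHom f` extends to `φ`.

Conjugation by `u` comes from comparing `limHom` along the constant sequence `u` with `limHom` along
`u` cut off at a late index. If the kernel were not non-archimedean, small kernel steps would lead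
far from `1`; carried out one after the other far out, they change the image uniformly little, and
pasting such chains gives a divergent sequence with convergent image ratio. -/

set_option linter.unusedSectionVars false

/-! ### Completeness of two-sided invariant metrics -/

/-- A complete compatible metric, as a bare distance function. -/
theorem exists_complete_dist (X : Type*) [t : TopologicalSpace X]
    [TopologicalSpace.IsCompletelyMetrizableSpace X] :
    ∃ ρ : X → X → ℝ, (∀ a b c, ρ a c ≤ ρ a b + ρ b c) ∧ (∀ a b, ρ a b = ρ b a) ∧
      (∀ p, ∀ s > 0, {q | ρ q p < s} ∈ 𝓝 p) ∧
      ∀ x : ℕ → X, (∀ ε > 0, ∃ N, ∀ a ≥ N, ∀ b ≥ N, ρ (x a) (x b) < ε) →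
        ∃ l, Tendsto x atTop (𝓝 l) := by
  obtain ⟨m, rfl, hmc⟩ := TopologicalSpace.IsCompletelyMetrizableSpace.complete (X := X)
  exact ⟨dist, dist_triangle, dist_comm, fun p s hs => Metric.ball_mem_nhds p hs,
    fun x hx => cauchySeq_tendsto_of_complete (Metric.cauchySeq_iff.2 hx)⟩

/-- A completely metrizable group with a two-sided invariant metric is complete. -/
theorem completeSpace_of_isIsometricSMul (H : Type*) [Group H] [MetricSpace H]
    [IsIsometricSMul H H] [IsIsometricSMul Hᵐᵒᵖ H]
    [TopologicalSpace.IsCompletelyMetrizableSpace H] : CompleteSpace H := by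
  obtain ⟨ρ, htri, hcomm, hnhds, hcomp⟩ := exists_complete_dist H
  refine Metric.complete_of_cauchySeq_tendsto (α := H) fun x hx => ?_
  have hcau : ∀ r > 0, ∃ N, ∀ n ≥ N, dist (x n) (x N) < r := Metric.cauchySeq_iff'.1 hx
  have hball : ∀ (p : H) (s : ℝ), 0 < s → ∃ r > 0, ∀ q, dist q p < r → ρ q p < s := by
    intro p s hs
    obtain ⟨r, hr, h⟩ := Metric.mem_nhds_iff.1 (hnhds p s hs)
    exact ⟨r, hr, fun q hq => h hq⟩
  -- A Baire category argument: for `y` in all `A k` the translated sequence `x n * y` is Cauchy for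
  -- the complete metric `ρ`, so it converges, and so does `x`.
  let A : ℕ → Set H := fun k => {y | ∃ r > 0, ∃ p : H, ∃ N, ∀ n ≥ N, ∀ q, dist q (x n * y) < r →
    ρ q p < 1 / (k + 1)}
  have hopen : ∀ k, IsOpen (A k) := by
    intro k
    refine Metric.isOpen_iff.2 fun y ⟨r, hr, p, N, h⟩ => ⟨r / 2, by positivity, fun y' hy' => ?_⟩
    refine ⟨r / 2, by positivity, p, N, fun n hn q hq => h n hn q ?_⟩
    have h1 : dist (x n * y') (x n * y) < r / 2 := by rw [dist_mul_left]; exact hy'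
    linarith [dist_triangle q (x n * y') (x n * y)]
  have hdense : ∀ k, Dense (A k) := by
    intro k
    refine Metric.dense_iff.2 fun y₀ s hs => ?_
    obtain ⟨n₀, hn₀⟩ := hcau s hs
    obtain ⟨r, hr, hrp⟩ := hball (x n₀ * y₀) (1 / (k + 1)) (by positivity)
    obtain ⟨n₂, hn₂⟩ := hcau (r / 4) (by positivity)
    set M := max n₀ n₂
    -- This point is chosen so that multiplying it by `x M` gives `x n₀ * y₀`; it is near `y₀`
    -- because `x M` is near `x n₀`.
    refine ⟨(x M)⁻¹ * x n₀ * y₀, ?_, r / 2, by positivity, x n₀ * y₀, M, fun n hn q hq => ?_⟩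
    · rw [Metric.mem_ball]
      have h1 := hn₀ M (le_max_left _ _)
      have : dist ((x M)⁻¹ * x n₀ * y₀) y₀ = dist (x n₀) (x M) := by
        rw [mul_assoc, ← dist_mul_left (x M), mul_inv_cancel_left, dist_mul_right]
      rw [this, dist_comm]; exact h1
    · apply hrp
      have h1 : dist (x n) (x M) < r / 2 := by
        have h1 := hn₂ n ((le_max_right _ _).trans hn)
        have h2 := hn₂ M (le_max_right n₀ n₂)
        rw [dist_comm] at h2
        linarith [dist_triangle (x n) (x n₂) (x M)]
      have h2 : dist (x n * ((x M)⁻¹ * x n₀ * y₀)) (x n₀ * y₀) = dist (x n) (x M) := by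
        have e : x n₀ * y₀ = x M * ((x M)⁻¹ * x n₀ * y₀) := by group
        conv_lhs => rw [e]
        rw [dist_mul_right]
      linarith [dist_triangle q (x n * ((x M)⁻¹ * x n₀ * y₀)) (x n₀ * y₀)]
  obtain ⟨y, hy⟩ := (dense_iInter_of_isOpen_nat hopen hdense).nonempty
  rw [Set.mem_iInter] at hy
  obtain ⟨l, hl⟩ := hcomp (fun n => x n * y) <| by
    intro ε hε
    obtain ⟨k, hk⟩ := exists_nat_one_div_lt (half_pos hε)
    obtain ⟨r, hr, p, N, h⟩ := hy k
    refine ⟨N, fun a ha b hb => ?_⟩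
    have h1 := h a ha (x a * y) (by simpa using hr)
    have h2 := h b hb (x b * y) (by simpa using hr)
    have h3 := htri (x a * y) p (x b * y)
    rw [hcomm p] at h3
    linarith
  refine ⟨l * y⁻¹, ?_⟩
  rw [tendsto_iff_dist_tendsto_zero] at hl ⊢
  refine hl.congr fun n => ?_
  rw [← dist_mul_right (x n) (l * y⁻¹) y, inv_mul_cancel_right]

/-! ### Lie groups have no small subgroups -/

/-- A Lie group has no small subgroups. -/
theorem exists_nhds_one_pow_mem_imp_eq_one {n : ℕ} {Q : Type*} [Group Q] [TopologicalSpace Q]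
    [ChartedSpace (EuclideanSpace ℝ (Fin n)) Q] [LieGroup (𝓡 n) ∞ Q] :
    ∃ V ∈ 𝓝 (1 : Q), ∀ x : Q, (∀ k : ℕ, x ^ k ∈ V) → x = 1 := by
  set E := EuclideanSpace ℝ (Fin n)
  set φ := extChartAt (𝓡 n) (1 : Q) with hφ
  set e : E := φ 1 with he
  have hsymm : φ.symm e = 1 := extChartAt_to_inv (I := 𝓡 n) (1 : Q)
  let μ : E × E → E := fun p => φ (φ.symm p.1 * φ.symm p.2)
  have hμ : ContDiffAt ℝ ∞ μ (e, e) := by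
    have h := (contMDiffAt_iff (I := (𝓡 n).prod (𝓡 n)) (I' := 𝓡 n)
      (f := fun p : Q × Q => p.1 * p.2)).1 ((contMDiff_mul (𝓡 n) ∞).contMDiffAt (x := ((1 : Q), (1 : Q))))
    have h2 := h.2
    simp only [extChartAt_prod, mul_one] at h2
    rw [ModelWithCorners.range_eq_univ, contDiffWithinAt_univ] at h2
    exact h2
  have hd : HasFDerivAt μ (fderiv ℝ μ (e, e)) (e, e) :=
    (hμ.differentiableAt (by simp)).hasFDerivAt
  set D := fderiv ℝ μ (e, e)
  have hnear : ∀ᶠ u in 𝓝 e, u ∈ φ.target := extChartAt_target_mem_nhds (I := 𝓡 n) (1 : Q)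
  have hl : ∀ v : E, D (v, 0) = v := by
    have h1 : HasFDerivAt (fun u : E => μ (u, e)) (D.comp (ContinuousLinearMap.inl ℝ E E)) e := by
      have : HasFDerivAt (fun u : E => (u, e)) (ContinuousLinearMap.inl ℝ E E) e :=
        hasFDerivAt_prodMk_left e e
      exact HasFDerivAt.comp e (g := μ) (f := fun u : E => (u, e)) hd this
    have h2 : HasFDerivAt (fun u : E => μ (u, e)) (ContinuousLinearMap.id ℝ E) e := by
      refine (hasFDerivAt_id e).congr_of_eventuallyEq ?_
      filter_upwards [hnear] with u hu
      simp [μ, hsymm, φ.right_inv hu]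
    intro v
    simpa using congrArg (fun T : E →L[ℝ] E => T v) (h1.unique h2)
  have hr : ∀ v : E, D (0, v) = v := by
    have h1 : HasFDerivAt (fun u : E => μ (e, u)) (D.comp (ContinuousLinearMap.inr ℝ E E)) e := by
      have : HasFDerivAt (fun u : E => (e, u)) (ContinuousLinearMap.inr ℝ E E) e :=
        hasFDerivAt_prodMk_right e e
      exact HasFDerivAt.comp e (g := μ) (f := fun u : E => (e, u)) hd this
    have h2 : HasFDerivAt (fun u : E => μ (e, u)) (ContinuousLinearMap.id ℝ E) e := by
      refine (hasFDerivAt_id e).congr_of_eventuallyEq ?_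
      filter_upwards [hnear] with u hu
      simp [μ, hsymm, φ.right_inv hu]
    intro v
    simpa using congrArg (fun T : E →L[ℝ] E => T v) (h1.unique h2)
  have hsq : HasFDerivAt (fun u : E => μ (u, u))
      (D.comp ((ContinuousLinearMap.id ℝ E).prod (ContinuousLinearMap.id ℝ E))) e :=
    HasFDerivAt.comp e (g := μ) (f := fun u : E => (u, u)) hd
      ((hasFDerivAt_id e).prodMk (hasFDerivAt_id e))
  have hee : μ (e, e) = e := by simp only [μ, hsymm, mul_one]; rfl
  -- In the chart, squaring has derivative `2 • id` at `e`, so near `e` it expands the distance to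
  -- `e` by any factor below `2`. Iterated squares of a nontrivial element must then leave the ball.
  have hexp : ∀ᶠ u in 𝓝 e, 3 / 2 * ‖u - e‖ ≤ ‖μ (u, u) - e‖ := by
    have h := hsq.isLittleO.def (show (0 : ℝ) < 1 / 2 by norm_num)
    filter_upwards [h] with u hu
    have h1 : D (u - e, u - e) = (2 : ℝ) • (u - e) := by
      have : ((u - e, u - e) : E × E) = (u - e, 0) + (0, u - e) := by simp
      rw [this, map_add, hl, hr, two_smul]
    simp only [hee, ContinuousLinearMap.comp_apply, ContinuousLinearMap.prod_apply,
      ContinuousLinearMap.id_apply, h1] at hu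
    have h2 : ‖(2 : ℝ) • (u - e)‖ = 2 * ‖u - e‖ := by rw [norm_smul]; norm_num
    have h3 := norm_sub_norm_le ((2 : ℝ) • (u - e)) (μ (u, u) - e)
    rw [norm_sub_rev ((2 : ℝ) • (u - e))] at h3
    linarith
  obtain ⟨r, hr0, hball⟩ := Metric.eventually_nhds_iff.1 hexp
  refine ⟨φ.source ∩ φ ⁻¹' Metric.ball e r, ?_, fun x hx => ?_⟩
  · exact inter_mem (extChartAt_source_mem_nhds (I := 𝓡 n) (1 : Q))
      ((continuousAt_extChartAt (I := 𝓡 n) (1 : Q)).preimage_mem_nhds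
        (Metric.ball_mem_nhds _ hr0))
  · have hgrow : ∀ k : ℕ, (3 / 2 : ℝ) ^ k * ‖φ x - e‖ ≤ ‖φ (x ^ 2 ^ k) - e‖ := by
      intro k
      induction k with
      | zero => simp
      | succ k ih =>
        have h1 := hball (y := φ (x ^ 2 ^ k)) (hx (2 ^ k)).2
        have h2 : μ (φ (x ^ 2 ^ k), φ (x ^ 2 ^ k)) = φ (x ^ 2 ^ (k + 1)) := by
          simp only [μ, φ.left_inv (hx (2 ^ k)).1]
          rw [← pow_add, ← two_mul, pow_succ' 2 k]
        rw [h2] at h1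
        calc (3 / 2 : ℝ) ^ (k + 1) * ‖φ x - e‖ = 3 / 2 * ((3 / 2 : ℝ) ^ k * ‖φ x - e‖) := by ring
          _ ≤ 3 / 2 * ‖φ (x ^ 2 ^ k) - e‖ := by gcongr
          _ ≤ _ := h1
    have hzero : ‖φ x - e‖ = 0 := by
      by_contra hne
      have hpos : 0 < ‖φ x - e‖ := lt_of_le_of_ne (norm_nonneg _) (Ne.symm hne)
      obtain ⟨k, hk⟩ := pow_unbounded_of_one_lt (r / ‖φ x - e‖) (show (1 : ℝ) < 3 / 2 by norm_num)
      rw [div_lt_iff₀ hpos] at hk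
      have h1 : ‖φ (x ^ 2 ^ k) - e‖ < r := by
        rw [← dist_eq_norm]; exact (hx (2 ^ k)).2
      linarith [hgrow k]
    have h1 : φ x = φ 1 := by rw [← he]; exact sub_eq_zero.1 (norm_eq_zero.1 hzero)
    exact φ.injOn (by simpa using (hx 1).1) (mem_extChartAt_source (I := 𝓡 n) (1 : Q)) h1

/-! ### From Borel reductions to generic points -/

/-- The group of eventually constant sequences with values in a subgroup. -/
def eventuallyConst {G : Type*} [Group G] (Γ : Subgroup G) : Subgroup (ℕ → G) where
  carrier := {x | (∀ n, x n ∈ Γ) ∧ ∃ N, ∀ n ≥ N, x n = x N}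
  one_mem' := ⟨fun _ => Γ.one_mem, 0, fun _ _ => rfl⟩
  mul_mem' := by
    rintro x y ⟨hx, M, hM⟩ ⟨hy, N, hN⟩
    refine ⟨fun n => Γ.mul_mem (hx n) (hy n), max M N, fun n hn => ?_⟩
    simp only [Pi.mul_apply]
    rw [hM n (le_trans (le_max_left _ _) hn), hN n (le_trans (le_max_right _ _) hn),
      hM _ (le_max_left _ _), hN _ (le_max_right _ _)]
  inv_mem' := by
    rintro x ⟨hx, M, hM⟩
    exact ⟨fun n => Γ.inv_mem (hx n), M, fun n hn => by simp only [Pi.inv_apply, hM n hn]⟩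

theorem countable_eventuallyConst {G : Type*} [Group G] (Γ : Subgroup G) [Countable Γ] :
    (eventuallyConst Γ : Set (ℕ → G)).Countable := by
  refine (Set.countable_range (fun p : (Σ N : ℕ, Fin (N + 1) → Γ) =>
    fun n : ℕ => ((p.2 ⟨min n p.1, by omega⟩ : Γ) : G))).mono ?_
  rintro x ⟨hx, N, hN⟩
  refine ⟨⟨N, fun i => ⟨x i, hx i⟩⟩, funext fun n => ?_⟩
  rcases le_total n N with h | h
  · simp [min_eq_left h]
  · simp [min_eq_right h, hN n h]

/-- The limit of the ratio of the images of two sequences. -/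
noncomputable def limRatio {X H : Type*} [Group H] [TopologicalSpace H] (f : X → ℕ → H)
    (a b : X) : H :=
  limUnder atTop fun l => f a l * (f b l)⁻¹

/-- A reduction of `E(G)` to `E(H)`, translated to a generic point: it is continuous at the
eventually constant sequences along the sequences lying in all `O k`, and the limits of ratios are
stable under changes far out. -/
structure GenericReduction {G H : Type*} [Group G] [TopologicalSpace G] [Group H] [MetricSpace H]
    (Γ : Subgroup G) (f : (ℕ → G) → ℕ → H) (O : ℕ → Set (ℕ → G)) : Prop where
  conv_iff : ∀ w w' : ℕ → G, (∃ g, Tendsto (fun n => w n * (w' n)⁻¹) atTop (𝓝 g)) ↔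
    ∃ h, Tendsto (fun l => f w l * (f w' l)⁻¹) atTop (𝓝 h)
  exists_mem : ∀ δ ∈ eventuallyConst Γ, ∀ k, ∃ N, ∀ w : ℕ → G, (∀ i < N, w i = δ i) → w ∈ O k
  exists_dist_le : ∀ δ ∈ eventuallyConst Γ, ∀ l, ∀ ε > 0, ∃ N, ∀ w : ℕ → G, (∀ k, w ∈ O k) →
    (∀ i < N, w i = δ i) → dist (f w l) (f δ l) ≤ ε
  stable : ∀ δ ∈ eventuallyConst Γ, ∀ δ' ∈ eventuallyConst Γ, ∀ ε > 0, ∃ N,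
    ∀ η ∈ eventuallyConst Γ, (∀ i < N, η i = 1) → ∀ l ≥ N,
      dist (f (δ * η) l * (f (δ' * η) l)⁻¹) (limRatio f δ δ') ≤ ε

theorem IsOpen.exists_forall_eq_imp_mem {G : Type*} [TopologicalSpace G] {U : Set (ℕ → G)}
    (hU : IsOpen U) {x : ℕ → G} (hx : x ∈ U) :
    ∃ N, ∀ y : ℕ → G, (∀ i < N, y i = x i) → y ∈ U := by
  obtain ⟨I, u, hu, hIu⟩ := isOpen_pi_iff.1 hU x hx
  refine ⟨I.sup id + 1, fun y hy => hIu fun i hi => ?_⟩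
  rw [hy i (Nat.lt_succ_of_le (Finset.le_sup (f := id) hi))]
  exact (hu i hi).2

/-- For countably many Borel sets there is a point whose orbit under a given countable group lies
in a `Gδ` set on which these Borel sets are relatively open. -/
theorem exists_generic {X : Type*} [Group X] [TopologicalSpace X] [IsTopologicalGroup X]
    [BaireSpace X] (S : Set (Set X)) (hS : S.Countable)
    (hSm : ∀ A ∈ S, @MeasurableSet X (borel X) A) (Δ : Subgroup X) (hΔ : (Δ : Set X).Countable) :
    ∃ (z : X) (O : ℕ → Set X), (∀ k, IsOpen (O k)) ∧ (∀ δ ∈ Δ, ∀ k, δ * z ∈ O k) ∧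
      ∀ A ∈ S, ∃ U, IsOpen U ∧ ∀ x, (∀ k, x ∈ O k) → (x ∈ A ↔ x ∈ U) := by
  let : MeasurableSpace X := borel X
  have : BorelSpace X := ⟨rfl⟩
  have h1 : ∀ A ∈ S, ∃ U, IsOpen U ∧ {x | x ∈ A ↔ x ∈ U} ∈ residual X := by
    intro A hA
    obtain ⟨U, hU, h⟩ := (hSm A hA).residualEq_isOpen
    refine ⟨U, hU, ?_⟩
    filter_upwards [h] with x hx
    exact iff_of_eq hx
  choose! U hU hAU using h1
  have h2 : (⋂ A ∈ S, {x | x ∈ A ↔ x ∈ U A}) ∈ residual X := (countable_bInter_mem hS).2 hAU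
  obtain ⟨t, htR, htG, htd⟩ := mem_residual.1 h2
  obtain ⟨O, hO, rfl⟩ := htG.eq_iInter_nat
  have h3 : (⋂ δ ∈ (Δ : Set X), {x | δ * x ∈ ⋂ n, O n}) ∈ residual X := by
    refine (countable_bInter_mem hΔ).2 fun δ _ => ?_
    exact tendsto_residual_of_isOpenMap (continuous_const_mul δ) (isOpenMap_mul_left δ)
      (mem_residual.2 ⟨_, subset_rfl, htG, htd⟩)
  obtain ⟨z, hz⟩ := (dense_of_mem_residual h3).nonempty
  simp only [Set.mem_iInter, Set.mem_ofPred_eq] at hz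
  refine ⟨z, O, hO, hz, fun A hA => ⟨U A, hU A hA, fun x hx => ?_⟩⟩
  have := htR (Set.mem_iInter.2 hx)
  simp only [Set.mem_iInter] at this
  exact this A hA

/-- Genericity is applied to two countable families. The sets `A₁` are preimages of basic open sets
under the coordinates of `θ`, and their relative openness is continuity. The sets `A₂` bound the
oscillation of a ratio beyond an index. If `z` lies in one of them, so does `η * z` for `η` far out,
and comparing the ratios at one index, by continuity, compares them at all later ones. -/
theorem exists_genericReduction {G H : Type*} [Group G] [TopologicalSpace G]
    [IsTopologicalGroup G] [PolishSpace G] [Group H] [MetricSpace H] [IsTopologicalGroup H]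
    [SecondCountableTopology H] [IsIsometricSMul H H] [IsIsometricSMul Hᵐᵒᵖ H]
    (Γ : Subgroup G) [Countable Γ] (hred : BorelReducible (seqEquiv G) (seqEquiv H)) :
    ∃ (f : (ℕ → G) → ℕ → H) (O : ℕ → Set (ℕ → G)), GenericReduction Γ f O := by
  obtain ⟨θ, hθ, hE⟩ := hred
  have hΔ := countable_eventuallyConst Γ
  have : Countable (eventuallyConst Γ) := hΔ
  let : MeasurableSpace (ℕ → G) := borel _
  have : BorelSpace (ℕ → G) := ⟨rfl⟩
  have hθl : ∀ l, @Measurable _ _ (borel _) (borel H) fun x => θ x l := fun l =>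
    (@Continuous.borel_measurable (ℕ → H) H _ _ (fun y => y l) (continuous_apply l)).comp hθ
  let : MeasurableSpace H := borel H
  have : BorelSpace H := ⟨rfl⟩
  let A₁ : ℕ × TopologicalSpace.countableBasis H → Set (ℕ → G) := fun p => {x | θ x p.1 ∈ p.2.1}
  let A₂ : eventuallyConst Γ × eventuallyConst Γ × ℕ × ℕ → Set (ℕ → G) := fun p =>
    {x | ∀ l ≥ p.2.2.1, ∀ l' ≥ p.2.2.1,
      dist (θ (p.1.1 * x) l * (θ (p.2.1.1 * x) l)⁻¹)
        (θ (p.1.1 * x) l' * (θ (p.2.1.1 * x) l')⁻¹) ≤ 1 / ((p.2.2.2 : ℝ) + 1)}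
  have hθδ : ∀ (δ : ℕ → G) l, Measurable fun x : ℕ → G => θ (δ * x) l := fun δ l =>
    (hθl l).comp (continuous_const_mul δ).measurable
  obtain ⟨z, O, hO, hz, hA⟩ := exists_generic (X := ℕ → G) (Set.range A₁ ∪ Set.range A₂)
    ((Set.countable_range _).union (Set.countable_range _)) (by
      rintro A (⟨p, rfl⟩ | ⟨p, rfl⟩)
      · exact hθl p.1 (TopologicalSpace.isOpen_of_mem_countableBasis p.2.2).measurableSet
      · simp only [A₂, Set.ofPred_forall]
        refine MeasurableSet.iInter fun l => MeasurableSet.iInter fun _ =>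
          MeasurableSet.iInter fun l' => MeasurableSet.iInter fun _ => ?_
        exact measurableSet_le (((hθδ _ _).mul (hθδ _ _).inv).dist ((hθδ _ _).mul (hθδ _ _).inv))
          measurable_const)
    (eventuallyConst Γ) hΔ
  have hcont : ∀ δ ∈ eventuallyConst Γ, ∀ l, ∀ ε > 0, ∃ N, ∀ w : ℕ → G, (∀ k, w * z ∈ O k) →
      (∀ i < N, w i = δ i) → dist (θ (w * z) l) (θ (δ * z) l) ≤ ε := by
    intro δ hδ l ε hε
    obtain ⟨B, hB, hxB, hBε⟩ := (TopologicalSpace.isBasis_countableBasis H).mem_nhds_iff.1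
      (Metric.ball_mem_nhds (θ (δ * z) l) hε)
    obtain ⟨U, hU, hUA⟩ := hA (A₁ (l, ⟨B, hB⟩)) (Or.inl ⟨_, rfl⟩)
    obtain ⟨N, hN⟩ := hU.exists_forall_eq_imp_mem ((hUA _ (hz δ hδ)).1 hxB)
    refine ⟨N, fun w hw hwδ => ?_⟩
    have : w * z ∈ U := hN _ fun i hi => by simp [hwδ i hi]
    exact (Metric.mem_ball.1 (hBε ((hUA _ hw).2 this))).le
  have hconv : ∀ w w' : ℕ → G, (∃ g, Tendsto (fun n => w n * (w' n)⁻¹) atTop (𝓝 g)) ↔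
      ∃ h, Tendsto (fun l => θ (w * z) l * (θ (w' * z) l)⁻¹) atTop (𝓝 h) := by
    intro w w'
    have h := hE (w * z) (w' * z)
    have h1 : (seqEquiv G) (w * z) (w' * z) ↔
        ∃ g, Tendsto (fun n => w n * (w' n)⁻¹) atTop (𝓝 g) := by
      change (∃ g, Tendsto (fun n => (w * z) n * ((w' * z) n)⁻¹) atTop (𝓝 g)) ↔ _
      simp [mul_assoc]
    exact h1.symm.trans h
  refine ⟨fun w => θ (w * z), fun k => {w | w * z ∈ O k}, hconv, ?_, hcont, ?_⟩
  · intro δ hδ k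
    obtain ⟨N, hN⟩ := (hO k).exists_forall_eq_imp_mem (hz δ hδ k)
    exact ⟨N, fun w hw => hN _ fun i hi => by simp [hw i hi]⟩
  · intro δ hδ δ' hδ' ε hε
    have hlim : Tendsto (fun l => θ (δ * z) l * (θ (δ' * z) l)⁻¹) atTop
        (𝓝 (limRatio (fun w => θ (w * z)) δ δ')) := by
      refine tendsto_nhds_limUnder ((hconv δ δ').1 ?_)
      obtain ⟨-, N, hN⟩ := (eventuallyConst Γ).mul_mem hδ ((eventuallyConst Γ).inv_mem hδ')
      exact ⟨_, tendsto_const_nhds.congr' ((eventually_ge_atTop N).mono fun n hn => (hN n hn).symm)⟩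
    set c := limRatio (fun w => θ (w * z)) δ δ'
    obtain ⟨n, hn⟩ := exists_nat_one_div_lt (show 0 < ε / 4 by positivity)
    have hε' : (0 : ℝ) < 1 / ((n : ℝ) + 1) := by positivity
    obtain ⟨L₁, hL₁⟩ := Metric.cauchySeq_iff.1 hlim.cauchySeq _ hε'
    obtain ⟨L₂, hL₂⟩ := Metric.tendsto_atTop.1 hlim (ε / 4) (by positivity)
    obtain ⟨U, hU, hUA⟩ := hA (A₂ (⟨δ, hδ⟩, ⟨δ', hδ'⟩, L₁, n)) (Or.inr ⟨_, rfl⟩)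
    have hzO : ∀ k, z ∈ O k := fun k => by simpa using hz 1 (eventuallyConst Γ).one_mem k
    obtain ⟨N₁, hN₁⟩ := hU.exists_forall_eq_imp_mem ((hUA z hzO).1
      fun l hl l' hl' => (hL₁ l hl l' hl').le)
    set L := max L₁ L₂
    obtain ⟨N₂, hN₂⟩ := hcont δ hδ L (ε / 4) (by positivity)
    obtain ⟨N₃, hN₃⟩ := hcont δ' hδ' L (ε / 4) (by positivity)
    refine ⟨max (max N₁ N₂) (max N₃ L), fun η hη hηN l hl => ?_⟩
    have hA₂ := (hUA (η * z) (hz η hη)).2 (hN₁ _ fun i hi => by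
      simp [hηN i (lt_of_lt_of_le hi (by simp))])
    have e1 := hA₂ l (le_trans (by simp [L]) hl) L (le_max_left _ _)
    have e2 := hN₂ (δ * η) (hz _ ((eventuallyConst Γ).mul_mem hδ hη)) fun i hi => by
      simp [hηN i (lt_of_lt_of_le hi (by simp))]
    have e3 := hN₃ (δ' * η) (hz _ ((eventuallyConst Γ).mul_mem hδ' hη)) fun i hi => by
      simp [hηN i (lt_of_lt_of_le hi (by simp))]
    have e4 := hL₂ L (le_max_right _ _)
    simp only [← mul_assoc] at e1
    have e5 : dist (θ (δ * η * z) L * (θ (δ' * η * z) L)⁻¹) (θ (δ * z) L * (θ (δ' * z) L)⁻¹)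
        ≤ ε / 4 + ε / 4 := by
      refine (dist_triangle _ (θ (δ * z) L * (θ (δ' * η * z) L)⁻¹) _).trans ?_
      rw [dist_mul_right, dist_mul_left, dist_inv_inv]
      exact add_le_add e2 e3
    have e6 := dist_triangle4 (θ (δ * η * z) l * (θ (δ' * η * z) l)⁻¹)
      (θ (δ * η * z) L * (θ (δ' * η * z) L)⁻¹) (θ (δ * z) L * (θ (δ' * z) L)⁻¹) c
    linarith

/-! ### Invariant metrics, tails and truncations -/

theorem dist_mul_mul_le_of_invariant {H : Type*} [Group H] [PseudoMetricSpace H]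
    [IsIsometricSMul H H] [IsIsometricSMul Hᵐᵒᵖ H] (a b c d : H) :
    dist (a * b) (c * d) ≤ dist a c + dist b d := by
  refine (dist_triangle _ (c * b) _).trans ?_
  rw [dist_mul_right, dist_mul_left]

theorem dist_mul_inv_one {H : Type*} [Group H] [PseudoMetricSpace H]
    [IsIsometricSMul Hᵐᵒᵖ H] (a b : H) : dist (a * b⁻¹) 1 = dist a b := by
  rw [← dist_mul_right (a * b⁻¹) 1 b, inv_mul_cancel_right, one_mul]

theorem dist_conj {H : Type*} [Group H] [PseudoMetricSpace H]
    [IsIsometricSMul H H] [IsIsometricSMul Hᵐᵒᵖ H] (h a b : H) :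
    dist (h * a * h⁻¹) (h * b * h⁻¹) = dist a b := by
  rw [dist_mul_right, dist_mul_left]

theorem dist_conj_one {H : Type*} [Group H] [PseudoMetricSpace H]
    [IsIsometricSMul H H] [IsIsometricSMul Hᵐᵒᵖ H] (h a : H) :
    dist (h * a * h⁻¹) 1 = dist a 1 := by
  simpa using dist_conj h a 1

theorem dist_inv_one {H : Type*} [Group H] [PseudoMetricSpace H]
    [IsIsometricSMul H H] [IsIsometricSMul Hᵐᵒᵖ H] (a : H) : dist a⁻¹ 1 = dist a 1 := by
  simpa using dist_inv_inv a 1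

theorem dist_mul_one_le {H : Type*} [Group H] [PseudoMetricSpace H]
    [IsIsometricSMul H H] [IsIsometricSMul Hᵐᵒᵖ H] (a b : H) :
    dist (a * b) 1 ≤ dist a 1 + dist b 1 := by
  simpa using dist_mul_mul_le_of_invariant a b 1 1

/-- Sequences that agree with their predecessors on longer and longer initial segments have a
limit. -/
theorem exists_forall_lt_eq {G : Type*} (x : ℕ → ℕ → G) (M : ℕ → ℕ) (hM : StrictMono M)
    (hx : ∀ k, ∀ i < M k, x (k + 1) i = x k i) : ∃ w : ℕ → G, ∀ k, ∀ i < M k, w i = x k i := by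
  have h : ∀ k m, k ≤ m → ∀ i < M k, x m i = x k i := by
    intro k m hkm
    induction m, hkm using Nat.le_induction with
    | base => exact fun i _ => rfl
    | succ m hkm ih =>
      intro i hi
      rw [hx m i (lt_of_lt_of_le hi (hM.monotone hkm)), ih i hi]
  refine ⟨fun i => x (i + 1) i, fun k i hi => ?_⟩
  rcases le_total (i + 1) k with hk | hk
  · exact (h _ _ hk i (lt_of_lt_of_le (Nat.lt_succ_self i) hM.le_apply)).symm
  · exact h _ _ hk i hi

/-- The sequence equal to `1` before `n` and to `g` from `n` on. -/
def tail {G : Type*} [One G] (n : ℕ) (g : G) : ℕ → G := fun i => if n ≤ i then g else 1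

theorem tail_of_le {G : Type*} [One G] {n i : ℕ} (h : n ≤ i) (g : G) : tail n g i = g := if_pos h

theorem tail_of_lt {G : Type*} [One G] {n i : ℕ} (h : i < n) (g : G) : tail n g i = 1 :=
  if_neg (not_le.2 h)

theorem tail_mem {G : Type*} [Group G] {Γ : Subgroup G} {g : G} (hg : g ∈ Γ) (n : ℕ) :
    tail n g ∈ eventuallyConst Γ := by
  refine ⟨fun i => ?_, n, fun i hi => ?_⟩
  · unfold tail; split_ifs; exacts [hg, Γ.one_mem]
  · rw [tail_of_le hi, tail_of_le le_rfl]

/-- The sequence that agrees with `a` before `M` and is `1` from `M` on. -/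
def truncate {G : Type*} [One G] (M : ℕ) (a : ℕ → G) : ℕ → G := fun i => if i < M then a i else 1

theorem truncate_of_lt {G : Type*} [One G] {M i : ℕ} (h : i < M) (a : ℕ → G) :
    truncate M a i = a i := if_pos h

theorem truncate_of_le {G : Type*} [One G] {M i : ℕ} (h : M ≤ i) (a : ℕ → G) :
    truncate M a i = 1 := if_neg (not_lt.2 h)

theorem truncate_mem {G : Type*} [Group G] {Γ : Subgroup G} {a : ℕ → G} (ha : ∀ i, a i ∈ Γ)
    (M : ℕ) : truncate M a ∈ eventuallyConst Γ := by
  refine ⟨fun i => ?_, M, fun i hi => ?_⟩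
  · unfold truncate; split_ifs; exacts [ha i, Γ.one_mem]
  · rw [truncate_of_le hi, truncate_of_le le_rfl]

theorem truncate_eq_one {G : Type*} [One G] {M i : ℕ} {a : ℕ → G} (h : a i = 1) :
    truncate M a i = 1 := by
  unfold truncate; split_ifs; exacts [h, rfl]

/-! ### Uniform continuity far out -/

namespace GenericReduction

variable {G H : Type*} [Group G] [MetricSpace G] [IsTopologicalGroup G]
  [IsIsometricSMul G G] [IsIsometricSMul Gᵐᵒᵖ G]
  [Group H] [MetricSpace H] [IsTopologicalGroup H]
  [IsIsometricSMul H H] [IsIsometricSMul Hᵐᵒᵖ H]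
  {Γ : Subgroup G} {f : (ℕ → G) → ℕ → H} {O : ℕ → Set (ℕ → G)}

theorem mem_of_mem (R : GenericReduction Γ f O) {δ : ℕ → G} (hδ : δ ∈ eventuallyConst Γ) (k : ℕ) :
    δ ∈ O k := by
  obtain ⟨N, hN⟩ := R.exists_mem δ hδ k
  exact hN δ fun _ _ => rfl

theorem eventually_mem (R : GenericReduction Γ f O) {δ : ℕ → G} (hδ : δ ∈ eventuallyConst Γ)
    (k : ℕ) : ∀ᶠ N in atTop, ∀ w : ℕ → G, (∀ i < N, w i = δ i) → w ∈ O k := by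
  obtain ⟨N, hN⟩ := R.exists_mem δ hδ k
  filter_upwards [eventually_ge_atTop N] with n hn w hw
  exact hN w fun i hi => hw i (hi.trans_le hn)

theorem eventually_dist_le (R : GenericReduction Γ f O) {δ : ℕ → G} (hδ : δ ∈ eventuallyConst Γ)
    (l : ℕ) {ε : ℝ} (hε : 0 < ε) : ∀ᶠ N in atTop, ∀ w : ℕ → G, (∀ k, w ∈ O k) →
      (∀ i < N, w i = δ i) → dist (f w l) (f δ l) ≤ ε := by
  obtain ⟨N, hN⟩ := R.exists_dist_le δ hδ l ε hε
  filter_upwards [eventually_ge_atTop N] with n hn w hw hwδ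
  exact hN w hw fun i hi => hwδ i (hi.trans_le hn)

theorem eventually_forall_dist_le (R : GenericReduction Γ f O) {δ : ℕ → G}
    (hδ : δ ∈ eventuallyConst Γ) (L : ℕ) {ε : ℝ} (hε : 0 < ε) :
    ∀ᶠ N in atTop, ∀ l < L, ∀ w : ℕ → G, (∀ k, w ∈ O k) →
      (∀ i < N, w i = δ i) → dist (f w l) (f δ l) ≤ ε :=
  (eventually_all_finite (Set.finite_lt_nat L)).2 fun l _ => R.eventually_dist_le hδ l hε

theorem eventually_stable (R : GenericReduction Γ f O) {δ δ' : ℕ → G}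
    (hδ : δ ∈ eventuallyConst Γ) (hδ' : δ' ∈ eventuallyConst Γ) {ε : ℝ} (hε : 0 < ε) :
    ∀ᶠ N in atTop, ∀ η ∈ eventuallyConst Γ, (∀ i < N, η i = 1) → ∀ l ≥ N,
      dist (f (δ * η) l * (f (δ' * η) l)⁻¹) (limRatio f δ δ') ≤ ε := by
  obtain ⟨N, hN⟩ := R.stable δ hδ δ' hδ' ε hε
  filter_upwards [eventually_ge_atTop N] with n hn η hη hη1 l hl
  exact hN η hη (fun i hi => hη1 i (hi.trans_le hn)) l (le_trans hn hl)

theorem tendsto_limRatio (R : GenericReduction Γ f O) {a b : ℕ → G}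
    (ha : a ∈ eventuallyConst Γ) (hb : b ∈ eventuallyConst Γ) :
    Tendsto (fun l => f a l * (f b l)⁻¹) atTop (𝓝 (limRatio f a b)) := by
  refine tendsto_nhds_limUnder ((R.conv_iff a b).1 ?_)
  obtain ⟨-, N, hN⟩ := (eventuallyConst Γ).mul_mem ha ((eventuallyConst Γ).inv_mem hb)
  exact ⟨_, tendsto_const_nhds.congr' ((eventually_ge_atTop N).mono fun n hn => (hN n hn).symm)⟩

theorem limRatio_mul (R : GenericReduction Γ f O) {a b c : ℕ → G} (ha : a ∈ eventuallyConst Γ)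
    (hb : b ∈ eventuallyConst Γ) (hc : c ∈ eventuallyConst Γ) :
    limRatio f a b * limRatio f b c = limRatio f a c := by
  refine tendsto_nhds_unique ?_ (R.tendsto_limRatio ha hc)
  simpa [mul_assoc] using (R.tendsto_limRatio ha hb).mul (R.tendsto_limRatio hb hc)

theorem limRatio_self (R : GenericReduction Γ f O) {a : ℕ → G} (ha : a ∈ eventuallyConst Γ) :
    limRatio f a a = 1 := by
  simpa using R.limRatio_mul ha ha ha

theorem limRatio_inv (R : GenericReduction Γ f O) {a b : ℕ → G} (ha : a ∈ eventuallyConst Γ)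
    (hb : b ∈ eventuallyConst Γ) : (limRatio f a b)⁻¹ = limRatio f b a := by
  rw [inv_eq_iff_mul_eq_one, R.limRatio_mul ha hb ha, R.limRatio_self ha]

theorem eventually_limRatio_stable (R : GenericReduction Γ f O) {δ δ' : ℕ → G}
    (hδ : δ ∈ eventuallyConst Γ) (hδ' : δ' ∈ eventuallyConst Γ) {ε : ℝ} (hε : 0 < ε) :
    ∀ᶠ N in atTop, ∀ η ∈ eventuallyConst Γ, (∀ i < N, η i = 1) →
      dist (limRatio f (δ * η) (δ' * η)) (limRatio f δ δ') ≤ ε := by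
  filter_upwards [R.eventually_stable hδ hδ' hε] with N hN η hη hη1
  refine le_of_tendsto ((R.tendsto_limRatio ((eventuallyConst Γ).mul_mem hδ hη)
    ((eventuallyConst Γ).mul_mem hδ' hη)).dist tendsto_const_nhds) ?_
  filter_upwards [eventually_ge_atTop N] with l hl
  exact hN η hη hη1 l hl

/-- A pair of finitely supported sequences together with a length and an index at which the
sequences extending them are controlled. -/
structure Stage (f : (ℕ → G) → ℕ → H) (O : ℕ → Set (ℕ → G)) (Γ : Subgroup G) (τ : ℝ) where
  α : ℕ → G
  β : ℕ → G
  M : ℕ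
  L : ℕ
  hα : α ∈ eventuallyConst Γ
  hβ : β ∈ eventuallyConst Γ
  α_one : ∀ j ≥ M, α j = 1
  β_one : ∀ j ≥ M, β j = 1
  dist_α : ∀ w : ℕ → G, (∀ k, w ∈ O k) → (∀ i < M, w i = α i) → dist (f w L) (f α L) ≤ τ
  dist_β : ∀ w : ℕ → G, (∀ k, w ∈ O k) → (∀ i < M, w i = β i) → dist (f w L) (f β L) ≤ τ
  dist_lim : dist (f α L * (f β L)⁻¹) (limRatio f α β) ≤ τ

/-- A stage extending another one by a pair of sequences with values close to each other and with
images far from each other. -/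
structure Stage.Next {τ : ℝ} (ε : ℝ) (k : ℕ) (s t : Stage f O Γ τ) : Prop where
  M_lt : s.M < t.M
  L_lt : s.L < t.L
  α_eq : ∀ i < s.M, t.α i = s.α i
  β_eq : ∀ i < s.M, t.β i = s.β i
  dist_lt : ∀ j ≥ s.M, dist (t.α j) (t.β j) < 1 / ((k : ℝ) + 1)
  mem_α : ∀ w : ℕ → G, (∀ i < t.M, w i = t.α i) → w ∈ O k
  mem_β : ∀ w : ℕ → G, (∀ i < t.M, w i = t.β i) → w ∈ O k
  exists_far : ∃ l ≥ s.L,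
    (∀ w : ℕ → G, (∀ k, w ∈ O k) → (∀ i < t.M, w i = t.α i) → dist (f w l) (f t.α l) ≤ τ) ∧
    (∀ w : ℕ → G, (∀ k, w ∈ O k) → (∀ i < t.M, w i = t.β i) → dist (f w l) (f t.β l) ≤ τ) ∧
    ε ≤ dist (f t.α l * (f t.β l)⁻¹) (limRatio f s.α s.β)

/-- One step of the pasting: a bad pair, placed beyond the present stage, makes the ratio leave its
previous limit at some index `l`. The five errors `τ` are two from truncating, two from replacing `f
(β * ·)` by a left translate of `f`, and one from the stability of the ratio of `α` to `β`. -/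
theorem Stage.exists_next (R : GenericReduction Γ f O) {ε τ : ℝ} (hτ : 0 < τ) (hε : 2 * τ < ε)
    (hbad : ∀ ρ > 0, ∀ I : ℕ, ∃ a ∈ eventuallyConst Γ, ∃ b ∈ eventuallyConst Γ,
      (∀ i < I, a i = 1) ∧ (∀ i < I, b i = 1) ∧ (∀ j, dist (a j) (b j) < ρ) ∧
        ∃ l, ε < dist (f a l) (f b l))
    (k : ℕ) (s : Stage f O Γ τ) : ∃ t : Stage f O Γ τ, s.Next (ε - 5 * τ) k t := by
  obtain ⟨N₀, h1, h2⟩ := ((R.eventually_stable s.hα s.hβ hτ).and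
    (R.eventually_stable s.hβ (eventuallyConst Γ).one_mem hτ)).exists
  obtain ⟨I, hI1, hIM, hIN⟩ := ((R.eventually_forall_dist_le (eventuallyConst Γ).one_mem
    (max N₀ s.L) hτ).and ((eventually_ge_atTop s.M).and (eventually_ge_atTop N₀))).exists
  obtain ⟨a, ha, b, hb, ha1, hb1, hab, l, hl⟩ := hbad (1 / ((k : ℝ) + 1)) (by positivity) I
  have hlL : max N₀ s.L ≤ l := by
    -- At small indices both images are close to `f 1 l` by continuity at `1`, so the images can
    -- only be far apart at a large index.
    by_contra! hlt
    have e1 := hI1 l hlt a (R.mem_of_mem ha) (by simpa using ha1)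
    have e2 := hI1 l hlt b (R.mem_of_mem hb) (by simpa using hb1)
    linarith [dist_triangle_right (f a l) (f b l) (f 1 l)]
  obtain ⟨M₁, hMa, hMb⟩ := ((R.eventually_dist_le ha l hτ).and
    (R.eventually_dist_le hb l hτ)).exists
  -- Truncation gives finite support, leaving room for later stages, and hardly moves the image at
  -- `l`.
  set a' := truncate M₁ a with ha'
  set b' := truncate M₁ b with hb'
  have ha'm : a' ∈ eventuallyConst Γ := truncate_mem ha.1 M₁
  have hb'm : b' ∈ eventuallyConst Γ := truncate_mem hb.1 M₁
  have ha'1 : ∀ i < I, a' i = 1 := fun i hi => truncate_eq_one (ha1 i hi)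
  have hb'1 : ∀ i < I, b' i = 1 := fun i hi => truncate_eq_one (hb1 i hi)
  have hα' := (eventuallyConst Γ).mul_mem s.hα ha'm
  have hβ' := (eventuallyConst Γ).mul_mem s.hβ hb'm
  -- The ratio is that of `α * a'` to `β * a'`, near `F`, times that of `β * a'` to `β * b'`. The
  -- latter is far from `1` because `f (β * a')` and `f (β * b')` are close at `l` to `h * f a'` and
  -- `h * f b'`.
  have hfar : ε - 5 * τ ≤ dist (f (s.α * a') l * (f (s.β * b') l)⁻¹) (limRatio f s.α s.β) := by
    have hN₀l : N₀ ≤ l := le_trans (le_max_left _ _) hlL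
    have e1 := hMa a' (R.mem_of_mem ha'm) fun i hi => truncate_of_lt hi a
    have e2 := hMb b' (R.mem_of_mem hb'm) fun i hi => truncate_of_lt hi b
    have e3 := h1 a' ha'm (fun i hi => ha'1 i (hi.trans_le hIN)) l hN₀l
    have e4 := h2 a' ha'm (fun i hi => ha'1 i (hi.trans_le hIN)) l hN₀l
    have e5 := h2 b' hb'm (fun i hi => hb'1 i (hi.trans_le hIN)) l hN₀l
    rw [one_mul] at e4 e5
    set F := limRatio f s.α s.β
    set h := limRatio f s.β 1
    have e6 : dist (f (s.β * a') l) (h * f a' l) ≤ τ := by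
      rw [← dist_mul_right _ _ (f a' l)⁻¹, mul_inv_cancel_right]; exact e4
    have e7 : dist (f (s.β * b') l) (h * f b' l) ≤ τ := by
      rw [← dist_mul_right _ _ (f b' l)⁻¹, mul_inv_cancel_right]; exact e5
    have e8 : dist (f a l) (f b l) ≤ dist (f a' l) (f b' l) + 2 * τ := by
      have := dist_triangle4 (f a l) (f a' l) (f b' l) (f b l)
      rw [dist_comm (f a l) (f a' l)] at this
      linarith
    have e9 : dist (f a' l) (f b' l) ≤ dist (f (s.β * a') l) (f (s.β * b') l) + 2 * τ := by
      rw [← dist_mul_left h]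
      have := dist_triangle4 (h * f a' l) (f (s.β * a') l) (f (s.β * b') l) (h * f b' l)
      rw [dist_comm (h * f a' l) (f (s.β * a') l)] at this
      linarith
    have e10 : dist (f (s.β * a') l) (f (s.β * b') l) ≤
        dist (f (s.α * a') l * (f (s.β * b') l)⁻¹) F + τ := by
      have h1 : dist (f (s.β * a') l) (f (s.β * b') l) =
          dist (F * (f (s.β * a') l * (f (s.β * b') l)⁻¹)) F := by
        rw [← dist_mul_right _ _ (f (s.β * b') l)⁻¹, mul_inv_cancel, ← dist_mul_left F, mul_one]
      have h2 : dist (F * (f (s.β * a') l * (f (s.β * b') l)⁻¹))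
          (f (s.α * a') l * (f (s.β * b') l)⁻¹) ≤ τ := by
        rw [← mul_assoc, dist_mul_right, ← dist_mul_right _ _ (f (s.β * a') l)⁻¹,
          mul_inv_cancel_right, dist_comm]
        exact e3
      rw [h1]
      linarith [dist_triangle (F * (f (s.β * a') l * (f (s.β * b') l)⁻¹))
        (f (s.α * a') l * (f (s.β * b') l)⁻¹) F]
    linarith
  obtain ⟨L', hL', hL'lt⟩ := (((Metric.tendsto_nhds.1 (R.tendsto_limRatio hα' hβ')) τ hτ).and
    (eventually_gt_atTop s.L)).exists
  obtain ⟨M', hM'⟩ := ((((R.eventually_dist_le hα' L' hτ).and (R.eventually_dist_le hβ' L' hτ)).and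
    ((R.eventually_dist_le hα' l hτ).and (R.eventually_dist_le hβ' l hτ))).and
    (((R.eventually_mem hα' k).and (R.eventually_mem hβ' k)).and
      ((eventually_gt_atTop s.M).and (eventually_ge_atTop M₁)))).exists
  obtain ⟨⟨⟨m1, m2⟩, m3, m4⟩, ⟨m5, m6⟩, m7, m8⟩ := hM'
  refine ⟨⟨s.α * a', s.β * b', M', L', hα', hβ', ?_, ?_, m1, m2, hL'.le⟩, m7, hL'lt, ?_, ?_, ?_,
    m5, m6, l, le_trans (le_max_right _ _) hlL, m3, m4, hfar⟩
  · intro j hj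
    simp [s.α_one j (m7.le.trans hj), a', truncate_of_le (m8.trans hj)]
  · intro j hj
    simp [s.β_one j (m7.le.trans hj), b', truncate_of_le (m8.trans hj)]
  · intro i hi
    simp [ha'1 i (hi.trans_le hIM)]
  · intro i hi
    simp [hb'1 i (hi.trans_le hIM)]
  · intro j hj
    simp only [Pi.mul_apply, s.α_one j hj, s.β_one j hj, one_mul]
    rcases lt_or_ge j M₁ with hjM | hjM
    · rw [ha', hb', truncate_of_lt hjM, truncate_of_lt hjM]; exact hab j
    · rw [ha', hb', truncate_of_le hjM, truncate_of_le hjM, dist_self]; positivity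

/-- Far out, sequences with values uniformly close to each other have images uniformly close to
each other. -/
theorem exists_forall_dist_le (R : GenericReduction Γ f O) {ε : ℝ} (hε : 0 < ε) :
    ∃ ρ > 0, ∃ I : ℕ, ∀ a ∈ eventuallyConst Γ, ∀ b ∈ eventuallyConst Γ,
      (∀ i < I, a i = 1) → (∀ i < I, b i = 1) → (∀ j, dist (a j) (b j) < ρ) →
        ∀ l, dist (f a l) (f b l) ≤ ε := by
  by_contra! hbad
  -- Between the indices `L` and `l` of a stage the ratio of the pasted sequences moves by at least
  -- `ε - 10 * τ`, while convergence allows less than `2 * τ`.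
  set τ := ε / 16 with hτdef
  have hτ : 0 < τ := by positivity
  choose next hnext using fun (k : ℕ) (s : Stage f O Γ τ) =>
    Stage.exists_next R hτ (by linarith : 2 * τ < ε) hbad k s
  have h1 := (eventuallyConst Γ).one_mem
  obtain ⟨M₀, hM₀⟩ := R.exists_dist_le 1 h1 0 τ hτ
  let s₀ : Stage f O Γ τ := ⟨1, 1, M₀, 0, h1, h1, fun _ _ => rfl, fun _ _ => rfl, hM₀, hM₀, by
    rw [R.limRatio_self h1, mul_inv_cancel, dist_self]; exact hτ.le⟩
  let s : ℕ → Stage f O Γ τ := fun k => Nat.rec s₀ next k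
  have hs : ∀ k, (s k).Next (ε - 5 * τ) k (s (k + 1)) := fun k => hnext k (s k)
  have hM : StrictMono fun k => (s k).M := strictMono_nat_of_lt_succ fun k => (hs k).M_lt
  have hL : StrictMono fun k => (s k).L := strictMono_nat_of_lt_succ fun k => (hs k).L_lt
  obtain ⟨u, hu⟩ := exists_forall_lt_eq (fun k => (s k).α) _ hM fun k => (hs k).α_eq
  obtain ⟨v, hv⟩ := exists_forall_lt_eq (fun k => (s k).β) _ hM fun k => (hs k).β_eq
  have huO : ∀ k, u ∈ O k := fun k => (hs k).mem_α u (hu (k + 1))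
  have hvO : ∀ k, v ∈ O k := fun k => (hs k).mem_β v (hv (k + 1))
  have huv : ∀ k, ∀ j ≥ (s k).M, dist (u j) (v j) < 1 / ((k : ℝ) + 1) := by
    intro k j hj
    have key : ∀ m ≥ k, j < (s m).M → dist (u j) (v j) < 1 / ((k : ℝ) + 1) := by
      intro m hm
      induction m, hm using Nat.le_induction with
      | base => exact fun h => absurd hj (not_le.2 h)
      | succ m hm ih =>
        intro hjm
        rcases lt_or_ge j (s m).M with h | h
        · exact ih h
        · rw [hu (m + 1) j hjm, hv (m + 1) j hjm]
          refine ((hs m).dist_lt j h).trans_le ?_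
          have : (k : ℝ) ≤ m := by exact_mod_cast hm
          gcongr
    exact key (max k (j + 1)) (le_max_left _ _)
      (lt_of_lt_of_le (Nat.lt_succ_self j) ((le_max_right _ _).trans hM.le_apply))
  have hlim : Tendsto (fun n => u n * (v n)⁻¹) atTop (𝓝 1) := by
    refine Metric.tendsto_atTop.2 fun r hr => ?_
    obtain ⟨k, hk⟩ := exists_nat_one_div_lt hr
    refine ⟨(s k).M, fun j hj => ?_⟩
    rw [dist_mul_inv_one]
    exact (huv k j hj).trans hk
  obtain ⟨c, hc⟩ := (R.conv_iff u v).1 ⟨1, hlim⟩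
  obtain ⟨k, hk⟩ := Metric.tendsto_atTop.1 hc τ hτ
  obtain ⟨l, hl, hlα, hlβ, hfar⟩ := (hs k).exists_far
  have hkL : k ≤ (s k).L := hL.le_apply
  have approx : ∀ {x y x' y' : H}, dist x x' ≤ τ → dist y y' ≤ τ →
      dist (x * y⁻¹) (x' * y'⁻¹) ≤ 2 * τ := fun {x y x' y'} hx hy => by
    have := dist_mul_mul_le_of_invariant x y⁻¹ x' y'⁻¹
    rw [dist_inv_inv] at this
    linarith
  have e1 := approx ((s k).dist_α u huO (hu k)) ((s k).dist_β v hvO (hv k))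
  have e2 := approx (hlα u huO (hu (k + 1))) (hlβ v hvO (hv (k + 1)))
  have e3 := hk _ hkL
  have e4 := hk l (hkL.trans hl)
  have e5 := (s k).dist_lim
  have e6 := dist_triangle4 (f (s (k + 1)).α l * (f (s (k + 1)).β l)⁻¹) (f u l * (f v l)⁻¹)
    (f u (s k).L * (f v (s k).L)⁻¹) (limRatio f (s k).α (s k).β)
  have e7 := dist_triangle (f u (s k).L * (f v (s k).L)⁻¹)
    (f (s k).α (s k).L * (f (s k).β (s k).L)⁻¹) (limRatio f (s k).α (s k).β)
  have e8 := dist_triangle_right (f u l * (f v l)⁻¹) (f u (s k).L * (f v (s k).L)⁻¹) c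
  rw [dist_comm] at e2
  linarith

theorem exists_forall_dist_limRatio_le (R : GenericReduction Γ f O) {ε : ℝ} (hε : 0 < ε) :
    ∃ ρ > 0, ∃ I : ℕ, ∀ a ∈ eventuallyConst Γ, ∀ b ∈ eventuallyConst Γ,
      (∀ i < I, a i = 1) → (∀ i < I, b i = 1) → (∀ j, dist (a j) (b j) < ρ) →
        dist (limRatio f a b) 1 ≤ ε := by
  obtain ⟨ρ, hρ, I, h⟩ := R.exists_forall_dist_le hε
  refine ⟨ρ, hρ, I, fun a ha b hb ha1 hb1 hab => ?_⟩
  refine le_of_tendsto ((R.tendsto_limRatio ha hb).dist tendsto_const_nhds) (.of_forall fun l => ?_)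
  rw [dist_mul_inv_one]
  exact h a ha b hb ha1 hb1 hab l

end GenericReduction

/-! ### Distance to a normal subgroup and products in the quotient -/

section InfDist

variable {H : Type*} [Group H] [MetricSpace H] [IsIsometricSMul H H] [IsIsometricSMul Hᵐᵒᵖ H]
  (N : Subgroup H)

theorem infDist_subgroup_nonempty : (N : Set H).Nonempty := ⟨1, N.one_mem⟩

theorem infDist_le_dist_one (x : H) : Metric.infDist x (N : Set H) ≤ dist x 1 :=
  Metric.infDist_le_dist_of_mem N.one_mem

theorem infDist_mul_le (x y : H) : Metric.infDist (x * y) (N : Set H) ≤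
    Metric.infDist x (N : Set H) + Metric.infDist y (N : Set H) := by
  refine le_of_forall_pos_lt_add fun ε hε => ?_
  obtain ⟨m, hm, h1⟩ := (Metric.infDist_lt_iff (infDist_subgroup_nonempty N)).1
    (lt_add_of_pos_right (Metric.infDist x (N : Set H)) (half_pos hε))
  obtain ⟨n, hn, h2⟩ := (Metric.infDist_lt_iff (infDist_subgroup_nonempty N)).1
    (lt_add_of_pos_right (Metric.infDist y (N : Set H)) (half_pos hε))
  have h3 := Metric.infDist_le_dist_of_mem (x := x * y) (N.mul_mem hm hn)
  linarith [dist_mul_mul_le_of_invariant x y m n]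

theorem infDist_conj [hN : N.Normal] (h x : H) :
    Metric.infDist (h * x * h⁻¹) (N : Set H) = Metric.infDist x (N : Set H) := by
  have key : ∀ h x : H, Metric.infDist (h * x * h⁻¹) (N : Set H) ≤ Metric.infDist x (N : Set H) := by
    intro h x
    refine (Metric.le_infDist (infDist_subgroup_nonempty N)).2 fun n hn => ?_
    rw [← dist_conj h x n]
    exact Metric.infDist_le_dist_of_mem (hN.conj_mem n hn h)
  refine le_antisymm (key h x) ?_
  simpa [mul_assoc] using key h⁻¹ (h * x * h⁻¹)

theorem infDist_inv (x : H) :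
    Metric.infDist x⁻¹ (N : Set H) = Metric.infDist x (N : Set H) := by
  have key : ∀ x : H, Metric.infDist x⁻¹ (N : Set H) ≤ Metric.infDist x (N : Set H) := by
    intro x
    refine (Metric.le_infDist (infDist_subgroup_nonempty N)).2 fun n hn => ?_
    rw [← dist_inv_inv x n]
    exact Metric.infDist_le_dist_of_mem (N.inv_mem hn)
  refine le_antisymm (key x) ?_
  simpa using key x⁻¹

end InfDist

/-- If all products of the elements `D k` in increasing order of indices, up to errors tending to
`0` fast, stay in a neighbourhood without nontrivial subgroups modulo `N`, then the `D k` come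
arbitrarily close to `N`. -/
theorem exists_infDist_lt_of_products_mem {H : Type*} [Group H] [MetricSpace H]
    [IsTopologicalGroup H] [IsIsometricSMul H H] [IsIsometricSMul Hᵐᵒᵖ H]
    (N : Subgroup H) [N.Normal] {V : Set (H ⧸ N)} (hVc : IsCompact V) (hVcl : IsClosed V)
    (hV : ∀ x : H ⧸ N, (∀ k : ℕ, x ^ k ∈ V) → x = 1)
    (P : ℕ → Set H) (D : ℕ → H) (hPV : ∀ k, ∀ p ∈ P k, (p : H ⧸ N) ∈ V)
    (hDV : ∀ k, (D k : H ⧸ N) ∈ V) (hP1 : ∀ k, 1 ∈ P k)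
    (hstay : ∀ k, ∀ p ∈ P k, ∃ p' ∈ P (k + 1), dist p' p ≤ (1 / 2) ^ k)
    (hmul : ∀ k, ∀ p ∈ P k, ∃ p' ∈ P (k + 1), dist p' (p * D k) ≤ (1 / 2) ^ k)
    {ε : ℝ} (hε : 0 < ε) : ∃ k, Metric.infDist (D k) (N : Set H) < ε := by
  by_contra! hfar
  -- Multiplying only at those rare `k` where `D k` is near the cluster point `d` modulo `N` yields
  -- elements of the `P k` approximating each power of `d`.
  obtain ⟨q, hq, hclus⟩ := hVc.exists_mapClusterPt (f := atTop) (u := fun k => (D k : H ⧸ N))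
    (le_principal_iff.2 (mem_map.2 (Eventually.of_forall hDV)))
  obtain ⟨d, rfl⟩ := QuotientGroup.mk_surjective q
  have hfreq : ∀ η > 0, ∃ᶠ k in atTop, Metric.infDist (D k * d⁻¹) (N : Set H) < η := by
    intro η hη
    have hO : (QuotientGroup.mk '' Metric.ball d η : Set (H ⧸ N)) ∈ 𝓝 (d : H ⧸ N) :=
      QuotientGroup.isOpenMap_coe.image_mem_nhds (Metric.ball_mem_nhds d hη)
    refine (hclus.frequently hO).mono fun k hk => ?_
    obtain ⟨x, hx, hxD⟩ := hk
    have hn : x⁻¹ * D k ∈ N := QuotientGroup.eq.1 hxD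
    have e : D k * d⁻¹ = (x * d⁻¹) * (d * (x⁻¹ * D k) * d⁻¹) := by group
    have h0 : Metric.infDist (x⁻¹ * D k) (N : Set H) = 0 := Metric.infDist_zero_of_mem hn
    rw [e]
    refine (infDist_mul_le N _ _).trans_lt ?_
    rw [infDist_conj, h0, add_zero]
    refine (infDist_le_dist_one N _).trans_lt ?_
    rw [dist_mul_inv_one]
    exact hx
  -- The bound is the sum of `(1 / 2) ^ j` over `m ≤ j < k`, in telescoping form.
  have htrans : ∀ m k, m ≤ k → ∀ p ∈ P m, ∃ p' ∈ P k,
      dist p' p ≤ 2 * (1 / 2 : ℝ) ^ m - 2 * (1 / 2) ^ k := by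
    intro m k hmk p hp
    induction k, hmk using Nat.le_induction with
    | base => exact ⟨p, hp, by simp⟩
    | succ k hmk ih =>
      obtain ⟨p', hp', h1⟩ := ih
      obtain ⟨p'', hp'', h2⟩ := hstay k p' hp'
      refine ⟨p'', hp'', ?_⟩
      have h3 : (1 / 2 : ℝ) ^ (k + 1) = (1 / 2) ^ k / 2 := by ring
      rw [h3]
      linarith [dist_triangle p'' p' p]
  have hpow : ∀ n : ℕ, ∀ η > 0, ∀ K, ∃ m ≥ K, ∃ p ∈ P m,
      Metric.infDist (p * (d ^ n)⁻¹) (N : Set H) < η := by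
    intro n
    induction n with
    | zero =>
      intro η hη K
      refine ⟨K, le_rfl, 1, hP1 K, ?_⟩
      have h0 : Metric.infDist (1 : H) (N : Set H) = 0 := Metric.infDist_zero_of_mem N.one_mem
      simpa [h0] using hη
    | succ n ih =>
      intro η hη K
      obtain ⟨K', hK'⟩ := exists_pow_lt_of_lt_one (show 0 < η / 8 by positivity)
        (show (1 / 2 : ℝ) < 1 by norm_num)
      obtain ⟨m, hm, p, hp, hpn⟩ := ih (η / 4) (by positivity) (max K K')
      obtain ⟨k, hk, hkm⟩ := ((hfreq (η / 4) (by positivity)).and_eventually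
        (eventually_ge_atTop m)).exists
      obtain ⟨p', hp', h1⟩ := htrans m k hkm p hp
      obtain ⟨p'', hp'', h2⟩ := hmul k p' hp'
      have hle : ∀ j ≥ K', (1 / 2 : ℝ) ^ j < η / 8 := fun j hj =>
        (pow_le_pow_of_le_one (by norm_num) (by norm_num) hj).trans_lt hK'
      have hm8 := hle m ((le_max_right _ _).trans hm)
      have hk8 := hle k (((le_max_right _ _).trans hm).trans hkm)
      have hk0 : (0 : ℝ) < (1 / 2) ^ k := by positivity
      refine ⟨k + 1, ((le_max_left _ _).trans hm).trans (hkm.trans (Nat.le_succ k)), p'', hp'', ?_⟩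
      have e1 : Metric.infDist (p' * (d ^ n)⁻¹) (N : Set H) < η / 4 + η / 4 := by
        have := Metric.infDist_le_infDist_add_dist (s := (N : Set H)) (x := p' * (d ^ n)⁻¹)
          (y := p * (d ^ n)⁻¹)
        rw [dist_mul_right] at this
        linarith
      have e2 : Metric.infDist (p' * D k * (d ^ (n + 1))⁻¹) (N : Set H) ≤
          Metric.infDist (p' * (d ^ n)⁻¹) (N : Set H) +
            Metric.infDist (D k * d⁻¹) (N : Set H) := by
        have e : p' * D k * (d ^ (n + 1))⁻¹ =
            (p' * (d ^ n)⁻¹) * (d ^ n * (D k * d⁻¹) * (d ^ n)⁻¹) := by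
          rw [pow_succ]; group
        rw [e]
        refine (infDist_mul_le N _ _).trans ?_
        rw [infDist_conj]
      have e3 := Metric.infDist_le_infDist_add_dist (s := (N : Set H))
        (x := p'' * (d ^ (n + 1))⁻¹) (y := p' * D k * (d ^ (n + 1))⁻¹)
      rw [dist_mul_right] at e3
      linarith
  have hone : (d : H ⧸ N) = 1 := by
    refine hV _ fun n => ?_
    by_contra hn
    have hopen : IsOpen ((QuotientGroup.mk : H → H ⧸ N) ⁻¹' Vᶜ) :=
      hVcl.isOpen_compl.preimage QuotientGroup.continuous_mk
    obtain ⟨r, hr, hball⟩ := Metric.isOpen_iff.1 hopen (d ^ n) hn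
    obtain ⟨m, -, p, hp, hpn⟩ := hpow n r hr 0
    obtain ⟨ν, hν, hd⟩ := (Metric.infDist_lt_iff (infDist_subgroup_nonempty N)).1 hpn
    have h1 : ν⁻¹ * p ∈ Metric.ball (d ^ n) r := by
      rw [Metric.mem_ball, ← dist_mul_left ν, mul_inv_cancel_left, ← dist_mul_right _ _ (d ^ n)⁻¹,
        mul_inv_cancel_right]
      exact hd
    have h2 : ((ν⁻¹ * p : H) : H ⧸ N) = p := by
      rw [QuotientGroup.mk_mul, (QuotientGroup.eq_one_iff ν⁻¹).2 (N.inv_mem hν), one_mul]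
    exact hball h1 (show ((ν⁻¹ * p : H) : H ⧸ N) ∈ V from h2 ▸ hPV m p hp)
  have hdN : Metric.infDist d (N : Set H) = 0 :=
    Metric.infDist_zero_of_mem ((QuotientGroup.eq_one_iff d).1 hone)
  obtain ⟨k, hk⟩ := (hfreq ε hε).exists
  have h1 := infDist_mul_le N (D k * d⁻¹) d
  rw [inv_mul_cancel_right, hdN] at h1
  linarith [hfar k]

/-! ### Ratios modulo a normal subgroup at a fixed scale -/

namespace GenericReduction

variable {G H : Type*} [Group G] [MetricSpace G] [IsTopologicalGroup G]
  [IsIsometricSMul G G] [IsIsometricSMul Gᵐᵒᵖ G]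
  [Group H] [MetricSpace H] [IsTopologicalGroup H]
  [IsIsometricSMul H H] [IsIsometricSMul Hᵐᵒᵖ H]
  {Γ : Subgroup G} {f : (ℕ → G) → ℕ → H} {O : ℕ → Set (ℕ → G)}

/-- A finite set of finitely supported sequences uniformly close to one of them. -/
structure Words (Γ : Subgroup G) (I : ℕ) (ρ : ℝ) where
  W : Set (ℕ → G)
  β : ℕ → G
  M : ℕ
  finite : W.Finite
  mem : ∀ δ ∈ W, δ ∈ eventuallyConst Γ
  hβ : β ∈ W
  eq_one_of_lt : ∀ δ ∈ W, ∀ i < I, δ i = 1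
  eq_one_of_le : ∀ δ ∈ W, ∀ i ≥ M, δ i = 1
  dist_lt : ∀ δ ∈ W, ∀ j, dist (δ j) (β j) < ρ

/-- By the cocycle identity the ratio of `a` to `b` is that of `a'` to `b'` between two outer
factors, which are nearly `h` and `h⁻¹`. It serves for a common prefix: multiplying two far-out
sequences on the left by it acts on their ratio as a conjugation. -/
theorem limRatio_conj (R : GenericReduction Γ f O) {a b a' b' : ℕ → G}
    (ha : a ∈ eventuallyConst Γ) (hb : b ∈ eventuallyConst Γ) (ha' : a' ∈ eventuallyConst Γ)
    (hb' : b' ∈ eventuallyConst Γ) (h : H) {r s : ℝ} (h1 : dist (limRatio f a a') h ≤ r)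
    (h2 : dist (limRatio f b b') h ≤ s) :
    dist (limRatio f a b) (h * limRatio f a' b' * h⁻¹) ≤ r + s := by
  have e : limRatio f a b = limRatio f a a' * limRatio f a' b' * (limRatio f b b')⁻¹ := by
    rw [R.limRatio_inv hb hb', R.limRatio_mul ha ha' hb', R.limRatio_mul ha hb' hb]
  rw [e]
  refine (dist_mul_mul_le_of_invariant _ _ _ _).trans (add_le_add ?_ ?_)
  · rw [dist_mul_right]; exact h1
  · rw [dist_inv_inv]; exact h2

/-- Each word is continued by either `a` or `b`, the base word by `b`. Continuing by `b` keeps the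
ratio to the base word up to a small error; continuing by `a` multiplies it by the new factor `D`.
The blocks have disjoint supports, so the words stay `ρ`-close to the base word however many factors
are used. -/
theorem Words.exists_next (R : GenericReduction Γ f O) (N : Subgroup H) [N.Normal] {I : ℕ}
    {ρ ε : ℝ} (hρ : 0 < ρ) (hε : 0 < ε)
    (hbad : ∀ J : ℕ, ∃ a ∈ eventuallyConst Γ, ∃ b ∈ eventuallyConst Γ,
      (∀ i < J, a i = 1) ∧ (∀ i < J, b i = 1) ∧ (∃ M, ∀ j ≥ M, a j = 1 ∧ b j = 1) ∧
        (∀ j, dist (a j) (b j) < ρ) ∧ ε < Metric.infDist (limRatio f a b) (N : Set H))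
    (k : ℕ) (s : Words Γ I ρ) : ∃ t : Words Γ I ρ, ∃ D : H,
      (∃ δ ∈ t.W, limRatio f δ t.β = D) ∧ ε / 2 ≤ Metric.infDist D (N : Set H) ∧
      (∀ δ ∈ s.W, ∃ δ' ∈ t.W, dist (limRatio f δ' t.β) (limRatio f δ s.β) ≤ (1 / 2) ^ k) ∧
      (∀ δ ∈ s.W, ∃ δ' ∈ t.W,
        dist (limRatio f δ' t.β) (limRatio f δ s.β * D) ≤ (1 / 2) ^ k) := by
  have hβ := s.mem _ s.hβ
  have hk : (0 : ℝ) < (1 / 2) ^ k := by positivity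
  obtain ⟨J, hJ1, hJ2, hJM, hJI⟩ := (((eventually_all_finite s.finite).2 fun δ hδ =>
    R.eventually_limRatio_stable (s.mem δ hδ) hβ hk).and
    ((R.eventually_limRatio_stable hβ (eventuallyConst Γ).one_mem (show 0 < ε / 4 by positivity)).and
      ((eventually_ge_atTop s.M).and (eventually_ge_atTop I)))).exists
  obtain ⟨a, ha, b, hb, ha1, hb1, ⟨M, hM⟩, hab, hfar⟩ := hbad J
  have hβa := (eventuallyConst Γ).mul_mem hβ ha
  have hβb := (eventuallyConst Γ).mul_mem hβ hb
  have hval : ∀ δ ∈ s.W, ∀ c : ℕ → G, (∀ i < J, c i = 1) → ∀ i,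
      ((δ * c) i = δ i ∧ (s.β * b) i = s.β i) ∨
      ((δ * c) i = c i ∧ (s.β * b) i = b i) := by
    intro δ hδ c hc i
    rcases lt_or_ge i J with hi | hi
    · left; simp [hc i hi, hb1 i hi]
    · right
      have h1 := s.eq_one_of_le δ hδ i (hJM.trans hi)
      have h2 := s.eq_one_of_le _ s.hβ i (hJM.trans hi)
      simp [h1, h2]
  let t : Words Γ I ρ :=
    { W := (fun δ => δ * a) '' s.W ∪ (fun δ => δ * b) '' s.W
      β := s.β * b
      M := max J M
      finite := (s.finite.image _).union (s.finite.image _)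
      mem := by
        rintro _ (⟨δ, hδ, rfl⟩ | ⟨δ, hδ, rfl⟩)
        exacts [(eventuallyConst Γ).mul_mem (s.mem δ hδ) ha,
          (eventuallyConst Γ).mul_mem (s.mem δ hδ) hb]
      hβ := Or.inr ⟨_, s.hβ, rfl⟩
      eq_one_of_lt := by
        rintro _ (⟨δ, hδ, rfl⟩ | ⟨δ, hδ, rfl⟩) i hi
        · simp [s.eq_one_of_lt δ hδ i hi, ha1 i (hi.trans_le hJI)]
        · simp [s.eq_one_of_lt δ hδ i hi, hb1 i (hi.trans_le hJI)]
      eq_one_of_le := by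
        rintro _ (⟨δ, hδ, rfl⟩ | ⟨δ, hδ, rfl⟩) i hi
        · simp [s.eq_one_of_le δ hδ i (hJM.trans ((le_max_left _ _).trans hi)),
            (hM i ((le_max_right _ _).trans hi)).1]
        · simp [s.eq_one_of_le δ hδ i (hJM.trans ((le_max_left _ _).trans hi)),
            (hM i ((le_max_right _ _).trans hi)).2]
      dist_lt := by
        rintro _ (⟨δ, hδ, rfl⟩ | ⟨δ, hδ, rfl⟩) i
        · rcases hval δ hδ a ha1 i with ⟨h1, h2⟩ | ⟨h1, h2⟩
          · beta_reduce; rw [h1, h2]; exact s.dist_lt δ hδ i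
          · beta_reduce; rw [h1, h2]; exact hab i
        · rcases hval δ hδ b hb1 i with ⟨h1, h2⟩ | ⟨h1, h2⟩
          · beta_reduce; rw [h1, h2]; exact s.dist_lt δ hδ i
          · beta_reduce; rw [h1, h2, dist_self]; exact hρ }
  refine ⟨t, limRatio f (s.β * a) (s.β * b), ⟨_, Or.inl ⟨_, s.hβ, rfl⟩, rfl⟩, ?_, ?_, ?_⟩
  · have e1 := hJ2 a ha ha1
    have e2 := hJ2 b hb hb1
    rw [one_mul] at e1 e2
    have e3 := R.limRatio_conj hβa hβb ha hb _ e1 e2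
    have e4 := Metric.infDist_le_infDist_add_dist (s := (N : Set H))
      (x := limRatio f s.β 1 * limRatio f a b * (limRatio f s.β 1)⁻¹)
      (y := limRatio f (s.β * a) (s.β * b))
    rw [infDist_conj, dist_comm] at e4
    linarith
  · exact fun δ hδ => ⟨δ * b, Or.inr ⟨δ, hδ, rfl⟩, hJ1 δ hδ b hb hb1⟩
  · intro δ hδ
    refine ⟨δ * a, Or.inl ⟨δ, hδ, rfl⟩, ?_⟩
    have e := hJ1 δ hδ a ha ha1
    change dist (limRatio f (δ * a) (s.β * b)) _ ≤ _
    rw [← R.limRatio_mul ((eventuallyConst Γ).mul_mem (s.mem δ hδ) ha) hβa hβb, dist_mul_right]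
    exact e

/-- Modulo a normal subgroup with a quotient that is locally compact without small subgroups, the
limits of ratios of uniformly close sequences tend to `1`. -/
theorem exists_forall_infDist_le (R : GenericReduction Γ f O) (N : Subgroup H) [N.Normal]
    {V : Set (H ⧸ N)} (hV1 : V ∈ 𝓝 1) (hVc : IsCompact V) (hVcl : IsClosed V)
    (hV : ∀ x : H ⧸ N, (∀ k : ℕ, x ^ k ∈ V) → x = 1) :
    ∃ ρ > 0, ∀ ε > 0, ∃ I : ℕ, ∀ a ∈ eventuallyConst Γ, ∀ b ∈ eventuallyConst Γ,
      (∀ i < I, a i = 1) → (∀ i < I, b i = 1) → (∃ M, ∀ j ≥ M, a j = 1 ∧ b j = 1) →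
        (∀ j, dist (a j) (b j) < ρ) → Metric.infDist (limRatio f a b) (N : Set H) ≤ ε := by
  have hVpre : (QuotientGroup.mk : H → H ⧸ N) ⁻¹' V ∈ 𝓝 (1 : H) :=
    QuotientGroup.continuous_mk.continuousAt.preimage_mem_nhds (by simpa using hV1)
  obtain ⟨r, hr, hrV⟩ := Metric.nhds_basis_closedBall.mem_iff.1 hVpre
  obtain ⟨ρ, hρ, I, hI⟩ := R.exists_forall_dist_limRatio_le hr
  refine ⟨ρ, hρ, ?_⟩
  -- The scale `ρ` depends only on `V`: it puts the ratios of all words to the base word into `V`,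
  -- and these ratios are the approximate products needed.
  by_contra! hbad
  obtain ⟨ε, hε, hbad⟩ := hbad
  choose next D hD1 hD2 hD3 hD4 using fun (k : ℕ) (s : Words Γ I ρ) =>
    Words.exists_next R N hρ hε hbad k s
  let s₀ : Words Γ I ρ :=
    { W := {1}
      β := 1
      M := 0
      finite := Set.finite_singleton _
      mem := by rintro _ rfl; exact (eventuallyConst Γ).one_mem
      hβ := rfl
      eq_one_of_lt := by rintro _ rfl _ _; rfl
      eq_one_of_le := by rintro _ rfl _ _; rfl
      dist_lt := by rintro _ rfl j; rw [dist_self]; exact hρ }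
  let s : ℕ → Words Γ I ρ := fun k => Nat.rec s₀ next k
  have hmemV : ∀ (t : Words Γ I ρ), ∀ δ ∈ t.W, ((limRatio f δ t.β : H) : H ⧸ N) ∈ V := fun t δ hδ =>
    hrV (hI δ (t.mem δ hδ) t.β (t.mem _ t.hβ) (t.eq_one_of_lt δ hδ) (t.eq_one_of_lt _ t.hβ)
      (t.dist_lt δ hδ))
  obtain ⟨k, hk⟩ := exists_infDist_lt_of_products_mem N hVc hVcl hV
    (fun k => (fun δ => limRatio f δ (s k).β) '' (s k).W) (fun k => D k (s k))
    (by rintro k _ ⟨δ, hδ, rfl⟩; exact hmemV _ δ hδ)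
    (by
      intro k
      obtain ⟨δ, hδ, h⟩ := hD1 k (s k)
      rw [← h]
      exact hmemV _ δ hδ)
    (fun k => ⟨_, (s k).hβ, R.limRatio_self ((s k).mem _ (s k).hβ)⟩)
    (by
      rintro k _ ⟨δ, hδ, rfl⟩
      obtain ⟨δ', hδ', h⟩ := hD3 k (s k) δ hδ
      exact ⟨_, ⟨δ', hδ', rfl⟩, h⟩)
    (by
      rintro k _ ⟨δ, hδ, rfl⟩
      obtain ⟨δ', hδ', h⟩ := hD4 k (s k) δ hδ
      exact ⟨_, ⟨δ', hδ', rfl⟩, h⟩)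
    (half_pos hε)
  exact absurd hk (not_lt.2 (hD2 k (s k)))

end GenericReduction

/-! ### Elements of the identity component have negligible effect on bounded blocks -/

/-- By density of `Γ` the closure of the generated subgroup contains a ball, so it is clopen and
contains the component. A generated element within `ρ` of `g` then differs from `g` by one more
small element of `Γ`. -/
theorem mem_closure_of_mem_connectedComponentOfOne {G : Type*} [Group G] [MetricSpace G]
    [IsTopologicalGroup G] [IsIsometricSMul G G] {Γ : Subgroup G} (hΓ : Dense (Γ : Set G)) {ρ : ℝ}
    (hρ : 0 < ρ) {g : G} (hg : g ∈ Γ) (hg₀ : g ∈ Subgroup.connectedComponentOfOne G) :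
    g ∈ Subgroup.closure {x | x ∈ Γ ∧ dist x 1 < ρ} := by
  set S := Subgroup.closure {x : G | x ∈ Γ ∧ dist x 1 < ρ} with hS
  have hball : Metric.ball (1 : G) ρ ⊆ S.topologicalClosure := by
    intro x hx
    have h := hΓ.open_subset_closure_inter Metric.isOpen_ball hx
    refine closure_mono ?_ h
    rintro y ⟨hy1, hy2⟩
    exact Subgroup.subset_closure ⟨hy2, hy1⟩
  have hopen : IsOpen (S.topologicalClosure : Set G) :=
    Subgroup.isOpen_of_mem_nhds _ (mem_of_superset (Metric.ball_mem_nhds 1 hρ) hball)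
  have hclopen : IsClopen (S.topologicalClosure : Set G) :=
    ⟨S.isClosed_topologicalClosure, hopen⟩
  have hgS : g ∈ closure (S : Set G) :=
    hclopen.connectedComponent_subset S.topologicalClosure.one_mem hg₀
  obtain ⟨s, hs, hd⟩ := Metric.mem_closure_iff.1 hgS ρ hρ
  have hsΓ : s ∈ Γ := (Subgroup.closure_le Γ).2 (fun x hx => hx.1) hs
  have h1 : s⁻¹ * g ∈ S := Subgroup.subset_closure ⟨Γ.mul_mem (Γ.inv_mem hsΓ) hg, by
    rw [← dist_mul_left s, mul_inv_cancel_left, mul_one]; exact hd⟩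
  simpa using S.mul_mem hs h1

/-- Every neighbourhood of the identity contains a normal subgroup whose quotient has a compact
neighbourhood of the identity without nontrivial cyclic subgroups. -/
def HasSmallNSSQuotients (H : Type*) [Group H] [MetricSpace H] : Prop :=
  ∀ ε > 0, ∃ (N : Subgroup H) (_ : N.Normal), (N : Set H) ⊆ Metric.ball 1 ε ∧
    ∃ V ∈ 𝓝 (1 : H ⧸ N), IsCompact V ∧ IsClosed V ∧ ∀ x : H ⧸ N, (∀ k : ℕ, x ^ k ∈ V) → x = 1

theorem IsProLie.hasSmallNSSQuotients {H : Type*} [Group H] [MetricSpace H] [IsTopologicalGroup H]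
    (h : IsProLie H) : HasSmallNSSQuotients H := by
  intro ε hε
  obtain ⟨N, hN, -, hNU, hT2, n, hC, hL⟩ := h.2 (Metric.ball 1 ε) Metric.isOpen_ball
    (Metric.mem_ball_self hε)
  refine ⟨N, hN, hNU, ?_⟩
  have : LocallyCompactSpace (H ⧸ N) :=
    ChartedSpace.locallyCompactSpace (EuclideanSpace ℝ (Fin n)) (H ⧸ N)
  obtain ⟨V, hV, hV1⟩ := exists_nhds_one_pow_mem_imp_eq_one (n := n) (Q := H ⧸ N)
  obtain ⟨K, hK, hKV, hKc⟩ := local_compact_nhds hV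
  exact ⟨K, hK, hKc, hKc.isClosed, fun x hx => hV1 x fun k => hKV (hx k)⟩

theorem tail_mul {G : Type*} [Group G] (n : ℕ) (g h : G) : tail n (g * h) = tail n g * tail n h := by
  ext i
  simp only [tail, Pi.mul_apply]
  split_ifs <;> simp

namespace GenericReduction

variable {G H : Type*} [Group G] [MetricSpace G] [IsTopologicalGroup G]
  [IsIsometricSMul G G] [IsIsometricSMul Gᵐᵒᵖ G]
  [Group H] [MetricSpace H] [IsTopologicalGroup H]
  [IsIsometricSMul H H] [IsIsometricSMul Hᵐᵒᵖ H]
  {Γ : Subgroup G} {f : (ℕ → G) → ℕ → H} {O : ℕ → Set (ℕ → G)}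

/-- Changing a finitely supported sequence far out by conjugates of an element of the group
generated by small elements has a negligible effect modulo `N`. -/
theorem exists_forall_infDist_le_of_mem_closure (R : GenericReduction Γ f O) (N : Subgroup H)
    [N.Normal] {ρ : ℝ}
    (hρ : ∀ ε > 0, ∃ I : ℕ, ∀ a ∈ eventuallyConst Γ, ∀ b ∈ eventuallyConst Γ,
      (∀ i < I, a i = 1) → (∀ i < I, b i = 1) → (∃ M, ∀ j ≥ M, a j = 1 ∧ b j = 1) →
        (∀ j, dist (a j) (b j) < ρ) → Metric.infDist (limRatio f a b) (N : Set H) ≤ ε)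
    (hρ0 : 0 < ρ) {g : G} (hg : g ∈ Subgroup.closure {x | x ∈ Γ ∧ dist x 1 < ρ}) :
    ∀ ε > 0, ∃ I : ℕ, ∀ a ∈ eventuallyConst Γ, ∀ b ∈ eventuallyConst Γ,
      (∀ i < I, a i = 1) → (∀ i < I, b i = 1) → (∃ M, ∀ j ≥ M, a j = 1 ∧ b j = 1) →
        (∀ j, a j = b j ∨ ∃ c ∈ Γ, a j = c * g * c⁻¹ * b j) →
          Metric.infDist (limRatio f a b) (N : Set H) ≤ ε := by
  have hle : Subgroup.closure {x : G | x ∈ Γ ∧ dist x 1 < ρ} ≤ Γ :=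
    (Subgroup.closure_le Γ).2 fun x hx => hx.1
  induction hg using Subgroup.closure_induction with
  | mem x hx =>
    intro ε hε
    obtain ⟨I, hI⟩ := hρ ε hε
    refine ⟨I, fun a ha b hb ha1 hb1 hM hab => hI a ha b hb ha1 hb1 hM fun j => ?_⟩
    rcases hab j with h | ⟨c, -, h⟩
    · rw [h, dist_self]; exact hρ0
    · rw [h, ← dist_mul_inv_one, mul_inv_cancel_right, dist_conj_one]; exact hx.2
  | one =>
    intro ε hε
    refine ⟨0, fun a ha b hb _ _ _ hab => ?_⟩
    have : a = b := funext fun j => by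
      rcases hab j with h | ⟨c, -, h⟩
      · exact h
      · simpa using h
    rw [this, R.limRatio_self hb, Metric.infDist_zero_of_mem N.one_mem]
    exact hε.le
  | mul x y hx hy ihx ihy =>
    intro ε hε
    obtain ⟨I, hI⟩ := ihx (ε / 2) (half_pos hε)
    obtain ⟨J, hJ⟩ := ihy (ε / 2) (half_pos hε)
    refine ⟨max I J, fun a ha b hb ha1 hb1 hM hab => ?_⟩
    have hc : ∀ j, ∃ c ∈ Γ, a j = b j ∨ a j = c * (x * y) * c⁻¹ * b j := fun j => by
      rcases hab j with h | ⟨c, hc, h⟩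
      exacts [⟨1, Γ.one_mem, Or.inl h⟩, ⟨c, hc, Or.inr h⟩]
    choose c hc hab using hc
    classical
    -- The intermediate sequence carries out only the `y`-part of the change; from `e` to `a` the
    -- change is by conjugates of `x`.
    let e : ℕ → G := fun j => if a j = b j then b j else c j * y * (c j)⁻¹ * b j
    have he_eq : ∀ j, a j = b j → e j = b j := fun j h => if_pos h
    obtain ⟨M, hM⟩ := hM
    have he1 : ∀ j ≥ M, e j = 1 := fun j hj => by
      rw [he_eq j ((hM j hj).1.trans (hM j hj).2.symm), (hM j hj).2]
    have he : e ∈ eventuallyConst Γ := by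
      refine ⟨fun j => ?_, M, fun j hj => by rw [he1 j hj, he1 M le_rfl]⟩
      simp only [e]
      split_ifs
      · exact hb.1 j
      · exact Γ.mul_mem (Γ.mul_mem (Γ.mul_mem (hc j) (hle hy)) (Γ.inv_mem (hc j))) (hb.1 j)
    have he0 : ∀ i < max I J, e i = 1 := fun i hi => by
      rw [he_eq i ((ha1 i hi).trans (hb1 i hi).symm), hb1 i hi]
    have h1 := hI a ha e he (fun i hi => ha1 i (hi.trans_le (le_max_left _ _)))
      (fun i hi => he0 i (hi.trans_le (le_max_left _ _))) ⟨M, fun j hj => ⟨(hM j hj).1, he1 j hj⟩⟩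
      fun j => by
        by_cases h : a j = b j
        · left; rw [he_eq j h, h]
        · right
          refine ⟨c j, hc j, ?_⟩
          simp only [e, if_neg h]
          rw [(hab j).resolve_left h]
          group
    have h2 := hJ e he b hb (fun i hi => he0 i (hi.trans_le (le_max_right _ _)))
      (fun i hi => hb1 i (hi.trans_le (le_max_right _ _))) ⟨M, fun j hj => ⟨he1 j hj, (hM j hj).2⟩⟩
      fun j => by
        by_cases h : a j = b j
        · left; exact he_eq j h
        · right
          exact ⟨c j, hc j, if_neg h⟩
    rw [← R.limRatio_mul ha he hb]
    linarith [infDist_mul_le N (limRatio f a e) (limRatio f e b)]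
  | inv x hx ih =>
    intro ε hε
    obtain ⟨I, hI⟩ := ih ε hε
    refine ⟨I, fun a ha b hb ha1 hb1 hM hab => ?_⟩
    rw [← infDist_inv, R.limRatio_inv ha hb]
    refine hI b hb a ha hb1 ha1 (hM.imp fun M hM j hj => (hM j hj).symm) fun j => ?_
    rcases hab j with h | ⟨c, hc, h⟩
    · exact Or.inl h.symm
    · exact Or.inr ⟨c, hc, by rw [h]; group⟩

/-- Changing a sequence on a bounded set of indices far out by conjugates of an element of the
identity component has a negligible effect. -/
theorem exists_forall_dist_limRatio_le_of_conj (R : GenericReduction Γ f O)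
    (hΓ : Dense (Γ : Set G)) (hH : HasSmallNSSQuotients H) {g : G} (hg : g ∈ Γ)
    (hg₀ : g ∈ Subgroup.connectedComponentOfOne G) {ε : ℝ} (hε : 0 < ε) :
    ∃ I : ℕ, ∀ a ∈ eventuallyConst Γ, ∀ b ∈ eventuallyConst Γ,
      (∀ i < I, a i = 1) → (∀ i < I, b i = 1) → (∃ M, ∀ j ≥ M, a j = b j) →
        (∀ j, a j = b j ∨ ∃ c ∈ Γ, a j = c * g * c⁻¹ * b j) → dist (limRatio f a b) 1 ≤ ε := by
  obtain ⟨N, hN, hNε, V, hV1, hVc, hVcl, hV⟩ := hH (ε / 4) (by positivity)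
  obtain ⟨ρ, hρ0, hρ⟩ := R.exists_forall_infDist_le N hV1 hVc hVcl hV
  obtain ⟨I, hI⟩ := R.exists_forall_infDist_le_of_mem_closure N hρ hρ0
    (mem_closure_of_mem_connectedComponentOfOne hΓ hρ0 hg hg₀) (ε / 4) (by positivity)
  refine ⟨I, fun a ha b hb ha1 hb1 ⟨M, hM⟩ hab => ?_⟩
  obtain ⟨M', hM', hMM'⟩ := ((R.eventually_limRatio_stable ha hb (show 0 < ε / 4 by positivity)).and
    (eventually_ge_atTop M)).exists
  -- Since `a` and `b` agree from `M` on, this one factor, trivial before `M'`, truncates both, and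
  -- stability reduces to finite support.
  have hη := (eventuallyConst Γ).mul_mem ((eventuallyConst Γ).inv_mem ha) (truncate_mem ha.1 M')
  have e1 := hM' (a⁻¹ * truncate M' a) hη fun i hi => by simp [truncate_of_lt hi]
  have e2 : b * (a⁻¹ * truncate M' a) = truncate M' b := by
    ext i
    rcases lt_or_ge i M' with hi | hi
    · simp [truncate_of_lt hi]
    · simp [truncate_of_le hi, hM i (hMM'.trans hi)]
  rw [mul_inv_cancel_left, e2] at e1
  have e3 := hI _ (truncate_mem ha.1 M') _ (truncate_mem hb.1 M')
    (fun i hi => truncate_eq_one (ha1 i hi)) (fun i hi => truncate_eq_one (hb1 i hi))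
    ⟨M', fun j hj => ⟨truncate_of_le hj a, truncate_of_le hj b⟩⟩ fun j => by
      rcases lt_or_ge j M' with hj | hj
      · rw [truncate_of_lt hj, truncate_of_lt hj]; exact hab j
      · rw [truncate_of_le hj, truncate_of_le hj]; exact Or.inl rfl
  obtain ⟨ν, hν, hd⟩ := (Metric.infDist_lt_iff (infDist_subgroup_nonempty N)).1
    (e3.trans_lt (show ε / 4 < ε / 2 by linarith))
  have e4 : dist ν 1 < ε / 4 := hNε hν
  have e5 := dist_triangle4 (limRatio f a b) (limRatio f (truncate M' a) (truncate M' b)) ν 1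
  rw [dist_comm] at e1
  linarith

/-! ### The homomorphism on the dense subgroup -/

/-- The homomorphism induced by a reduction, on elements of `Γ` in the identity component. -/
noncomputable def limHom (f : (ℕ → G) → ℕ → H) (g : G) : H :=
  limUnder atTop fun n => limRatio f (tail n g) 1

/-- The sequences `tail I g` and `tail n g` differ, by `g`, only on the block from `I` to `n`, which
is negligible for large `I`; so the ratios form a Cauchy sequence. -/
theorem tendsto_limHom [CompleteSpace H] (R : GenericReduction Γ f O)
    (hΓ : Dense (Γ : Set G)) (hH : HasSmallNSSQuotients H) {g : G} (hg : g ∈ Γ)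
    (hg₀ : g ∈ Subgroup.connectedComponentOfOne G) :
    Tendsto (fun n => limRatio f (tail n g) 1) atTop (𝓝 (limHom f g)) := by
  refine tendsto_nhds_limUnder (cauchySeq_tendsto_of_complete (Metric.cauchySeq_iff'.2 ?_))
  intro ε hε
  obtain ⟨I, hI⟩ := R.exists_forall_dist_limRatio_le_of_conj hΓ hH hg hg₀ (half_pos hε)
  refine ⟨I, fun n hn => ?_⟩
  have h := hI (tail I g) (tail_mem hg I) (tail n g) (tail_mem hg n) (fun i hi => tail_of_lt hi g)
    (fun i hi => tail_of_lt (hi.trans_le hn) g)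
    ⟨n, fun j hj => by rw [tail_of_le hj, tail_of_le (le_trans hn hj)]⟩ fun j => by
      rcases lt_or_ge j I with hj | hj
      · left; rw [tail_of_lt hj, tail_of_lt (hj.trans_le hn)]
      · rcases lt_or_ge j n with hj' | hj'
        · right; exact ⟨1, Γ.one_mem, by simp [tail_of_le hj, tail_of_lt hj']⟩
        · left; rw [tail_of_le hj, tail_of_le hj']
  rw [← R.limRatio_mul (tail_mem hg I) (tail_mem hg n) (eventuallyConst Γ).one_mem, dist_comm]
  have e := dist_mul_right (limRatio f (tail I g) (tail n g)) 1 (limRatio f (tail n g) 1)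
  rw [one_mul] at e
  rw [e]
  linarith

/-- By the cocycle identity it suffices that the ratio of `tail J g * tail J h` to `tail J h` is
close to that of `tail J g` to `1`. Stability allows cutting `tail J h` off at a late `M`. The
remaining block `s` is negligible both alone and after `tail J g`, where it amounts to a change by
`g * h * g⁻¹`; conjugates are needed for this. -/
theorem limHom_mul [CompleteSpace H] (R : GenericReduction Γ f O)
    (hΓ : Dense (Γ : Set G)) (hH : HasSmallNSSQuotients H) {g h : G} (hg : g ∈ Γ)
    (hg₀ : g ∈ Subgroup.connectedComponentOfOne G) (hh : h ∈ Γ)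
    (hh₀ : h ∈ Subgroup.connectedComponentOfOne G) :
    limHom f (g * h) = limHom f g * limHom f h := by
  have h1 := R.tendsto_limHom hΓ hH (Γ.mul_mem hg hh) (mul_mem hg₀ hh₀)
  have h2 := (R.tendsto_limHom hΓ hH hg hg₀).mul (R.tendsto_limHom hΓ hH hh hh₀)
  refine tendsto_nhds_unique h1 (h2.congr_dist ?_)
  refine Metric.tendsto_atTop.2 fun ε hε => ?_
  obtain ⟨I, hI⟩ := R.exists_forall_dist_limRatio_le_of_conj hΓ hH hh hh₀
    (show 0 < ε / 4 by positivity)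
  refine ⟨I, fun J hJ => ?_⟩
  have hgJ := tail_mem hg J
  have hhJ := tail_mem hh J
  have hghJ := (eventuallyConst Γ).mul_mem hgJ hhJ
  have h1m := (eventuallyConst Γ).one_mem
  obtain ⟨M, hM, hJM⟩ := ((R.eventually_limRatio_stable hghJ hhJ
    (show 0 < ε / 4 by positivity)).and (eventually_ge_atTop J)).exists
  have hη := (eventuallyConst Γ).inv_mem (tail_mem hh M)
  have e1 := hM _ hη fun i hi => by simp [tail_of_lt hi]
  rw [mul_assoc] at e1
  set s := tail J h * (tail M h)⁻¹ with hs
  have hsm : s ∈ eventuallyConst Γ := (eventuallyConst Γ).mul_mem hhJ hη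
  have hs1 : ∀ i < J, s i = 1 := fun i hi => by
    simp [hs, tail_of_lt hi, tail_of_lt (hi.trans_le hJM)]
  have hs2 : ∀ i, J ≤ i → i < M → s i = h := fun i hi hi' => by
    simp [hs, tail_of_le hi, tail_of_lt hi']
  have hs3 : ∀ i ≥ M, s i = 1 := fun i hi => by
    simp [hs, tail_of_le hi, tail_of_le (hJM.trans hi)]
  have e2 := hI (tail J g * s) ((eventuallyConst Γ).mul_mem hgJ hsm) (tail J g) hgJ
    (fun i hi => by simp [tail_of_lt (hi.trans_le hJ), hs1 i (hi.trans_le hJ)])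
    (fun i hi => tail_of_lt (hi.trans_le hJ) g)
    ⟨M, fun j hj => by simp [hs3 j hj]⟩ fun j => by
      rcases lt_or_ge j J with hj | hj
      · left; simp [hs1 j hj]
      · rcases lt_or_ge j M with hj' | hj'
        · right; exact ⟨g, hg, by simp [tail_of_le hj, hs2 j hj hj']⟩
        · left; simp [hs3 j hj']
  have e3 := hI s hsm 1 h1m (fun i hi => hs1 i (hi.trans_le hJ)) (fun _ _ => rfl)
    ⟨M, fun j hj => by simp [hs3 j hj]⟩ fun j => by
      rcases lt_or_ge j J with hj | hj
      · left; simp [hs1 j hj]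
      · rcases lt_or_ge j M with hj' | hj'
        · right; exact ⟨1, Γ.one_mem, by simp [hs2 j hj hj']⟩
        · left; simp [hs3 j hj']
  have e4 := R.limRatio_conj ((eventuallyConst Γ).mul_mem hgJ hsm) hsm hgJ h1m 1 e2 e3
  rw [one_mul, inv_one, mul_one] at e4
  have e5 : dist (limRatio f (tail J g) 1 * limRatio f (tail J h) 1)
      (limRatio f (tail J (g * h)) 1) =
        dist (limRatio f (tail J g * tail J h) (tail J h)) (limRatio f (tail J g) 1) := by
    rw [tail_mul, ← R.limRatio_mul hghJ hhJ h1m, dist_mul_right, dist_comm]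
  rw [Real.dist_0_eq_abs, abs_of_nonneg dist_nonneg, e5]
  have e6 := dist_triangle (limRatio f (tail J g * tail J h) (tail J h))
    (limRatio f (tail J g * s) s) (limRatio f (tail J g) 1)
  rw [dist_comm] at e1
  linarith

theorem exists_forall_dist_limHom_le [CompleteSpace H] (R : GenericReduction Γ f O)
    (hΓ : Dense (Γ : Set G)) (hH : HasSmallNSSQuotients H) {ε : ℝ} (hε : 0 < ε) :
    ∃ ρ > 0, ∀ g ∈ Γ, g ∈ Subgroup.connectedComponentOfOne G → dist g 1 < ρ →
      dist (limHom f g) 1 ≤ ε := by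
  obtain ⟨ρ, hρ, I, hI⟩ := R.exists_forall_dist_limRatio_le hε
  refine ⟨ρ, hρ, fun g hg hg₀ hgρ => ?_⟩
  refine le_of_tendsto ((R.tendsto_limHom hΓ hH hg hg₀).dist tendsto_const_nhds) ?_
  filter_upwards [eventually_ge_atTop I] with n hn
  refine hI _ (tail_mem hg n) 1 (eventuallyConst Γ).one_mem
    (fun i hi => tail_of_lt (hi.trans_le hn) g) (fun _ _ => rfl) fun j => ?_
  unfold tail
  split_ifs
  · exact hgρ
  · simpa using hρ

/-- Passing from `δ * tail n g` to `δ` through `tail n g` and `1` gives three ratios; the first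
tends to `limRatio f δ 1` by stability. -/
theorem tendsto_limRatio_mul_tail [CompleteSpace H] (R : GenericReduction Γ f O)
    (hΓ : Dense (Γ : Set G)) (hH : HasSmallNSSQuotients H) {δ : ℕ → G}
    (hδ : δ ∈ eventuallyConst Γ) {g : G} (hg : g ∈ Γ)
    (hg₀ : g ∈ Subgroup.connectedComponentOfOne G) :
    Tendsto (fun n => limRatio f (δ * tail n g) δ) atTop
      (𝓝 (limRatio f δ 1 * limHom f g * (limRatio f δ 1)⁻¹)) := by
  have h1m := (eventuallyConst Γ).one_mem
  have h1 : Tendsto (fun n => limRatio f (δ * tail n g) (tail n g)) atTop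
      (𝓝 (limRatio f δ 1)) := by
    refine Metric.tendsto_nhds.2 fun ε hε => ?_
    obtain ⟨N, hN⟩ := (R.eventually_limRatio_stable hδ h1m (half_pos hε)).exists
    filter_upwards [eventually_ge_atTop N] with n hn
    have := hN (tail n g) (tail_mem hg n) fun i hi => tail_of_lt (hi.trans_le hn) g
    rw [one_mul] at this
    linarith
  refine ((h1.mul (R.tendsto_limHom hΓ hH hg hg₀)).mul_const _).congr fun n => ?_
  have hn := tail_mem hg n
  rw [R.limRatio_inv hδ h1m, R.limRatio_mul ((eventuallyConst Γ).mul_mem hδ hn) hn h1m,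
    R.limRatio_mul ((eventuallyConst Γ).mul_mem hδ hn) h1m hδ]

/-- The homomorphism of a reduction intertwines conjugations with limits of conjugations. -/
theorem exists_tendsto_conj_limHom [CompleteSpace H] (R : GenericReduction Γ f O)
    (hΓ : Dense (Γ : Set G)) (hH : HasSmallNSSQuotients H) {u : G} (hu : u ∈ Γ) :
    ∃ h : ℕ → H, ∀ g ∈ Γ, g ∈ Subgroup.connectedComponentOfOne G →
      Tendsto (fun n => h n * limHom f g * (h n)⁻¹) atTop (𝓝 (limHom f (u * g * u⁻¹))) := by
  have h1m := (eventuallyConst Γ).one_mem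
  set U := tail 0 u with hU
  have hUi : ∀ i, U i = u := fun i => tail_of_le (Nat.zero_le i) u
  have hUm : U ∈ eventuallyConst Γ := tail_mem hu 0
  -- The constant sequence `U` conjugates `limHom f g` by `limRatio f U 1`; the sequence equal to
  -- `u` before `M` and `1` afterwards does the same to `limHom f (u * g * u⁻¹)` with its own ratio.
  -- The witness is the quotient of the two conjugators.
  refine ⟨fun M => (limRatio f (U * (tail M u)⁻¹) 1)⁻¹ * limRatio f U 1, fun g hg hg₀ => ?_⟩
  have hg' : u * g * u⁻¹ ∈ Γ := Γ.mul_mem (Γ.mul_mem hu hg) (Γ.inv_mem hu)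
  have hg₀' : u * g * u⁻¹ ∈ Subgroup.connectedComponentOfOne G :=
    (identityComponent_normal G).conj_mem g hg₀ u
  refine Metric.tendsto_nhds.2 fun ε hε => ?_
  set τ := ε / 8 with hτdef
  have hτ : 0 < τ := by positivity
  obtain ⟨I, hI⟩ := R.exists_forall_dist_limRatio_le_of_conj hΓ hH hg hg₀ hτ
  obtain ⟨N₁, hN₁⟩ := (R.eventually_limRatio_stable hUm h1m hτ).exists
  obtain ⟨n, hn, hnI, hnN⟩ := ((Metric.tendsto_nhds.1
    (R.tendsto_limRatio_mul_tail hΓ hH hUm hg hg₀) τ hτ).and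
    ((eventually_ge_atTop I).and (eventually_ge_atTop N₁))).exists
  have hUn := (eventuallyConst Γ).mul_mem hUm (tail_mem hg n)
  filter_upwards [R.eventually_limRatio_stable hUn hUm hτ, eventually_ge_atTop n] with M hM hnM
  have hη := (eventuallyConst Γ).inv_mem (tail_mem hu M)
  have e1 := hM _ hη fun i hi => by simp [tail_of_lt hi]
  set v := U * (tail M u)⁻¹ with hv
  have hvm : v ∈ eventuallyConst Γ := (eventuallyConst Γ).mul_mem hUm hη
  obtain ⟨M', hM', hMM'⟩ := ((Metric.tendsto_nhds.1
    (R.tendsto_limRatio_mul_tail hΓ hH hvm hg' hg₀') τ hτ).and (eventually_ge_atTop M)).exists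
  -- After left multiplication by `U`, both sequences equal `u` before `n` and `u * g * u⁻¹` from
  -- `M'` on. In between, `x'` is a change of `y'` by `g`, hence negligible.
  set x' := tail n g * (tail M u)⁻¹ with hx'
  set y' := (tail M u)⁻¹ * tail M' (u * g * u⁻¹) with hy'
  have hx'm : x' ∈ eventuallyConst Γ := (eventuallyConst Γ).mul_mem (tail_mem hg n) hη
  have hy'm : y' ∈ eventuallyConst Γ := (eventuallyConst Γ).mul_mem hη (tail_mem hg' M')
  have hx'1 : ∀ i < n, x' i = 1 := fun i hi => by
    simp [hx', tail_of_lt hi, tail_of_lt (hi.trans_le hnM)]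
  have hy'1 : ∀ i < n, y' i = 1 := fun i hi => by
    simp [hy', tail_of_lt (hi.trans_le hnM), tail_of_lt (hi.trans_le (hnM.trans hMM'))]
  have hxe : U * tail n g * (tail M u)⁻¹ = U * x' := mul_assoc _ _ _
  have hye : v * tail M' (u * g * u⁻¹) = U * y' := mul_assoc _ _ _
  rw [hxe] at e1
  rw [hye] at hM'
  have hUx := (eventuallyConst Γ).mul_mem hUm hx'm
  have hUy := (eventuallyConst Γ).mul_mem hUm hy'm
  have e2 := hI x' hx'm y' hy'm (fun i hi => hx'1 i (hi.trans_le hnI))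
    (fun i hi => hy'1 i (hi.trans_le hnI))
    ⟨M', fun j hj => by
      simp [hx', hy', tail_of_le hj, tail_of_le (hMM'.trans hj),
        tail_of_le (hnM.trans (hMM'.trans hj)), mul_assoc]⟩ fun j => by
      rcases lt_or_ge j n with hj | hj
      · left; rw [hx'1 j hj, hy'1 j hj]
      rcases lt_or_ge j M' with hj' | hj'
      · right
        exact ⟨1, Γ.one_mem, by simp [hx', hy', tail_of_le hj, tail_of_lt hj']⟩
      · left
        simp [hx', hy', tail_of_le hj, tail_of_le (hMM'.trans hj'), tail_of_le hj', mul_assoc]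
  have e3 := hN₁ x' hx'm fun i hi => hx'1 i (hi.trans_le hnN)
  have e4 := hN₁ y' hy'm fun i hi => hy'1 i (hi.trans_le hnN)
  rw [one_mul] at e3 e4
  have e5 := R.limRatio_conj hUx hUy hx'm hy'm _ e3 e4
  set h := limRatio f U 1
  set h' := limRatio f v 1
  have e6 : dist (limRatio f (U * x') v) (limRatio f (U * y') v) ≤ 3 * τ := by
    rw [← R.limRatio_mul hUx hUy hvm]
    have := dist_mul_right (limRatio f (U * x') (U * y')) 1 (limRatio f (U * y') v)
    rw [one_mul] at this
    rw [this]
    have h3 := dist_triangle (limRatio f (U * x') (U * y')) (h * limRatio f x' y' * h⁻¹) 1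
    rw [dist_conj_one] at h3
    linarith
  have e7 : dist (h'⁻¹ * h * limHom f g * (h'⁻¹ * h)⁻¹) (limHom f (u * g * u⁻¹)) =
      dist (h * limHom f g * h⁻¹) (h' * limHom f (u * g * u⁻¹) * h'⁻¹) := by
    rw [← dist_conj h']
    congr 1
    group
  rw [e7]
  have e8 := dist_triangle4 (h * limHom f g * h⁻¹) (limRatio f (U * tail n g) U)
    (limRatio f (U * x') v) (limRatio f (U * y') v)
  have e9 := dist_triangle (h * limHom f g * h⁻¹) (limRatio f (U * y') v)
    (h' * limHom f (u * g * u⁻¹) * h'⁻¹)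
  rw [dist_comm] at hn e1
  linarith

end GenericReduction

/-! ### Extension to the identity component -/

/-- A uniformly continuous homomorphism from a dense subgroup to a complete group extends. -/
theorem exists_continuous_monoidHom_extension {C H : Type*} [Group C] [MetricSpace C]
    [IsTopologicalGroup C] [Group H] [MetricSpace H] [IsTopologicalGroup H] [CompleteSpace H]
    (S : Subgroup C) (hS : Dense (S : Set C)) (ψ : S →* H) (hψ : UniformContinuous ψ) :
    ∃ φ : C →* H, Continuous φ ∧ ∀ x : S, φ x = ψ x := by
  have hψ' : UniformContinuous (fun x : (S : Set C) => ψ x) := hψ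
  have hcont : Continuous (hS.extend fun x : (S : Set C) => ψ x) :=
    (hS.uniformContinuous_extend hψ').continuous
  have hext : ∀ x : S, hS.extend (fun x : (S : Set C) => ψ x) (x : C) = ψ x :=
    fun x => hS.extend_of_ind hψ' x
  refine ⟨MonoidHom.mk' (hS.extend fun x : (S : Set C) => ψ x) ?_, hcont, hext⟩
  intro a b
  have hclosed : IsClosed {p : C × C | hS.extend (fun x : (S : Set C) => ψ x) (p.1 * p.2) =
      hS.extend (fun x : (S : Set C) => ψ x) p.1 * hS.extend (fun x : (S : Set C) => ψ x) p.2} :=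
    isClosed_eq (by fun_prop) (by fun_prop)
  have hall : ∀ p : C × C, p ∈ {p : C × C | hS.extend (fun x : (S : Set C) => ψ x) (p.1 * p.2) =
      hS.extend (fun x : (S : Set C) => ψ x) p.1 * hS.extend (fun x : (S : Set C) => ψ x) p.2} := by
    intro p
    refine (hS.prod hS).induction ?_ hclosed p
    rintro ⟨x, y⟩ ⟨hx, hy⟩
    have e1 := hext ⟨x, hx⟩
    have e2 := hext ⟨y, hy⟩
    have e3 := hext (⟨x, hx⟩ * ⟨y, hy⟩)
    rw [map_mul] at e3
    change hS.extend (fun x : (S : Set C) => ψ x) (x * y) = hS.extend (fun x : (S : Set C) => ψ x) x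
      * hS.extend (fun x : (S : Set C) => ψ x) y
    rw [e1, e2]
    exact e3
  exact hall (a, b)

theorem exists_countable_dense_subgroup (G : Type*) [Group G] [TopologicalSpace G]
    [TopologicalSpace.SeparableSpace G] :
    ∃ Γ : Subgroup G, Countable Γ ∧ Dense (Γ : Set G) := by
  obtain ⟨s, hs, hd⟩ := TopologicalSpace.exists_countable_dense G
  refine ⟨Subgroup.closure s, ?_, hd.mono Subgroup.subset_closure⟩
  have : Countable s := hs
  have hfree : Countable (FreeGroup s) := Quot.mk_surjective.countable
  rw [← Subtype.range_coe (s := s), ← FreeGroup.range_lift_eq_closure]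
  exact (MonoidHom.rangeRestrict_surjective _).countable

namespace GenericReduction

variable {G H : Type*} [Group G] [MetricSpace G] [IsTopologicalGroup G]
  [IsIsometricSMul G G] [IsIsometricSMul Gᵐᵒᵖ G]
  [Group H] [MetricSpace H] [IsTopologicalGroup H]
  [IsIsometricSMul H H] [IsIsometricSMul Hᵐᵒᵖ H]
  {Γ : Subgroup G} {f : (ℕ → G) → ℕ → H} {O : ℕ → Set (ℕ → G)}

theorem dense_subgroupOf_connectedComponentOfOne (hΓ : Dense (Γ : Set G))
    (hG₀ : IsOpen (Subgroup.connectedComponentOfOne G : Set G)) :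
    Dense (Γ.subgroupOf (Subgroup.connectedComponentOfOne G) :
      Set (Subgroup.connectedComponentOfOne G)) :=
  hΓ.preimage hG₀.isOpenMap_subtype_val

/-- The continuous homomorphism on the identity component induced by a reduction. -/
theorem exists_monoidHom [CompleteSpace H] (R : GenericReduction Γ f O)
    (hΓ : Dense (Γ : Set G)) (hH : HasSmallNSSQuotients H)
    (hG₀ : IsOpen (Subgroup.connectedComponentOfOne G : Set G)) :
    ∃ φ : Subgroup.connectedComponentOfOne G →* H, Continuous φ ∧
      ∀ g : Subgroup.connectedComponentOfOne G, (g : G) ∈ Γ → φ g = limHom f g := by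
  let ψ : Γ.subgroupOf (Subgroup.connectedComponentOfOne G) →* H :=
    MonoidHom.mk' (fun x => limHom f ((x : Subgroup.connectedComponentOfOne G) : G)) fun x y =>
      R.limHom_mul hΓ hH x.2 x.1.2 y.2 y.1.2
  have hψ : UniformContinuous ψ := by
    refine Metric.uniformContinuous_iff.2 fun ε hε => ?_
    obtain ⟨ρ, hρ, h⟩ := R.exists_forall_dist_limHom_le hΓ hH (half_pos hε)
    refine ⟨ρ, hρ, fun {x y} hxy => ?_⟩
    have h1 := h ((x * y⁻¹ : Γ.subgroupOf (Subgroup.connectedComponentOfOne G)) :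
      Subgroup.connectedComponentOfOne G) (x * y⁻¹).2 (x * y⁻¹).1.2 (by
        have : dist ((x : Subgroup.connectedComponentOfOne G) : G)
          ((y : Subgroup.connectedComponentOfOne G) : G) < ρ := hxy
        rw [← dist_mul_inv_one] at this
        exact this)
    have h2 : dist (ψ (x * y⁻¹)) 1 ≤ ε / 2 := h1
    rw [map_mul, map_inv, dist_mul_inv_one] at h2
    linarith
  obtain ⟨φ, hφ, hφψ⟩ := exists_continuous_monoidHom_extension _
    (dense_subgroupOf_connectedComponentOfOne hΓ hG₀) ψ hψ
  exact ⟨φ, hφ, fun g hg => hφψ ⟨g, hg⟩⟩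

/-! ### The kernel is non-archimedean -/

/-- Multiplying far out by a small constant has a uniformly small effect. -/
theorem exists_forall_dist_mul_tail_le (R : GenericReduction Γ f O) {ε : ℝ} (hε : 0 < ε) :
    ∃ ρ > 0, ∀ δ ∈ eventuallyConst Γ, ∀ᶠ n in atTop, ∀ k ∈ Γ, dist k 1 < ρ →
      ∀ l, dist (f (δ * tail n k) l) (f δ l) ≤ ε := by
  have h1m := (eventuallyConst Γ).one_mem
  obtain ⟨ρ, hρ, I, hI⟩ := R.exists_forall_dist_le (half_pos hε)
  refine ⟨ρ, hρ, fun δ hδ => ?_⟩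
  obtain ⟨N, hN⟩ := (R.eventually_stable hδ h1m (show 0 < ε / 4 by positivity)).exists
  filter_upwards [R.eventually_forall_dist_le hδ N hε, eventually_ge_atTop I,
    eventually_ge_atTop N] with n hn hnI hnN k hk hkρ l
  have hkm := tail_mem hk n
  rcases lt_or_ge l N with hl | hl
  · exact hn l hl _ (R.mem_of_mem ((eventuallyConst Γ).mul_mem hδ hkm)) fun i hi => by
      simp [tail_of_lt hi]
  · have e1 := hN _ hkm (fun i hi => tail_of_lt (hi.trans_le hnN) k) l hl
    have e2 := hN 1 h1m (fun _ _ => rfl) l hl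
    rw [one_mul] at e1
    rw [mul_one, mul_one] at e2
    have e3 := hI _ hkm 1 h1m (fun i hi => tail_of_lt (hi.trans_le hnI) k) (fun _ _ => rfl)
      (fun j => by
        unfold tail
        split_ifs
        · exact hkρ
        · simpa using hρ) l
    set h := limRatio f δ 1
    rw [← dist_mul_right _ _ (f (tail n k) l), inv_mul_cancel_right] at e1
    rw [← dist_mul_right _ _ (f 1 l), inv_mul_cancel_right] at e2
    rw [← dist_mul_left h] at e3
    have e4 := dist_triangle4 (f (δ * tail n k) l) (h * f (tail n k) l) (h * f 1 l) (f δ l)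
    rw [dist_comm (h * f 1 l)] at e4
    linarith

/-- Elements reached from `1` by small steps in the kernel are approximated by the final values of
sequences with image uniformly close to the image of a given sequence. -/
theorem exists_forall_dist_le_of_mem_closure_ker [CompleteSpace H] (R : GenericReduction Γ f O)
    (hΓ : Dense (Γ : Set G)) (hH : HasSmallNSSQuotients H)
    (hG₀ : IsOpen (Subgroup.connectedComponentOfOne G : Set G))
    {φ : Subgroup.connectedComponentOfOne G →* H} (hφ : Continuous φ)
    (hφf : ∀ g : Subgroup.connectedComponentOfOne G, (g : G) ∈ Γ → φ g = limHom f g)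
    {ε : ℝ} (hε : 0 < ε) :
    ∃ ρ > 0, ∀ p ∈ Subgroup.closure
      {k : Subgroup.connectedComponentOfOne G | φ k = 1 ∧ dist k 1 < ρ},
      ∀ β ∈ eventuallyConst Γ, ∀ I : ℕ, ∀ τ > 0, ∃ ξ ∈ eventuallyConst Γ, (∀ i < I, ξ i = 1) ∧
        (∃ g : Subgroup.connectedComponentOfOne G, (g : G) ∈ Γ ∧ dist g p < τ ∧
          ∃ J, ∀ j ≥ J, ξ j = g) ∧
        (∀ l, dist (f (β * ξ) l) (f β l) ≤ ε + τ) ∧ dist (limRatio f (β * ξ) β) 1 ≤ τ := by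
  obtain ⟨ρ, hρ, hstep⟩ := R.exists_forall_dist_mul_tail_le hε
  refine ⟨ρ / 2, half_pos hρ, fun p hp β hβ I => ?_⟩
  have hdense := dense_subgroupOf_connectedComponentOfOne hΓ hG₀
  -- The errors of successive steps do not add up. Before an index `L` a far-out step changes the
  -- image hardly at all; from `L` on the previous deviation has died out, since the limit ratio is
  -- near `1`, and only the single step costs `ε`. The limit ratio stays near `1` because the step
  -- nearly lies in the kernel.
  have step : ∀ p s : Subgroup.connectedComponentOfOne G, φ p = 1 → φ s = 1 →
      dist s 1 < ρ / 2 →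
      (∀ τ > 0, ∃ ξ ∈ eventuallyConst Γ, (∀ i < I, ξ i = 1) ∧
        (∃ g : Subgroup.connectedComponentOfOne G, (g : G) ∈ Γ ∧ dist g p < τ ∧
          ∃ J, ∀ j ≥ J, ξ j = g) ∧
        (∀ l, dist (f (β * ξ) l) (f β l) ≤ ε + τ) ∧ dist (limRatio f (β * ξ) β) 1 ≤ τ) →
      (∀ τ > 0, ∃ ξ ∈ eventuallyConst Γ, (∀ i < I, ξ i = 1) ∧
        (∃ g : Subgroup.connectedComponentOfOne G, (g : G) ∈ Γ ∧ dist g (p * s) < τ ∧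
          ∃ J, ∀ j ≥ J, ξ j = g) ∧
        (∀ l, dist (f (β * ξ) l) (f β l) ≤ ε + τ) ∧ dist (limRatio f (β * ξ) β) 1 ≤ τ) := by
    intro p s hp hs hsρ ih τ hτ
    have hnear : ∀ q : Subgroup.connectedComponentOfOne G, φ q = 1 → ∃ r > 0, r ≤ τ / 4 ∧
        r ≤ ρ / 4 ∧ ∀ g, dist g q < r → dist (φ g) 1 < τ / 8 := by
      intro q hq
      obtain ⟨r, hr, h⟩ := Metric.continuousAt_iff.1 hφ.continuousAt (τ / 8) (by positivity)
      refine ⟨min r (min (τ / 4) (ρ / 4)), by positivity,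
        (min_le_right _ _).trans (min_le_left _ _), (min_le_right _ _).trans (min_le_right _ _),
        fun g hg => ?_⟩
      rw [← hq]
      exact h (hg.trans_le (min_le_left _ _))
    obtain ⟨r, hr, hrτ, hrρ, hrφ⟩ := hnear p hp
    obtain ⟨r', hr', hrτ', hrρ', hrφ'⟩ := hnear (p * s) (by rw [map_mul, hp, hs, mul_one])
    obtain ⟨ξ, hξ, hξ1, ⟨g, hgΓ, hgp, J, hJ⟩, hsup, hlim⟩ := ih r hr
    obtain ⟨g', hg'Γ, hgp'⟩ := hdense.exists_dist_lt (p * s) hr'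
    have hg'Γ' : (g' : G) ∈ Γ := hg'Γ
    rw [dist_comm] at hgp'
    -- The points `p` and `s` need not lie in `Γ`, so the actual step joins approximations of `p`
    -- and `p * s`; halving `ρ` leaves room for this.
    set k := g⁻¹ * g' with hk
    have hkΓ : (k : G) ∈ Γ := Γ.mul_mem (Γ.inv_mem hgΓ) hg'Γ'
    have hkρ : dist (k : G) 1 < ρ := by
      have e1 : dist (k : G) 1 = dist g' g := by
        rw [Subtype.dist_eq, ← dist_mul_left ((g : G)⁻¹) (g' : G) (g : G), inv_mul_cancel]
        rfl
      have e2 : dist (p * s) p = dist s 1 := by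
        have := dist_mul_left (p : G) (s : G) 1
        rw [mul_one] at this
        exact this
      have e3 := dist_triangle4 g' (p * s) p g
      rw [dist_comm p g] at e3
      rw [e1]
      linarith
    have hkφ : dist (limHom f (k : G)) 1 < τ / 4 := by
      rw [← hφf k hkΓ, hk, map_mul, map_inv]
      have e1 := dist_mul_one_le (φ g)⁻¹ (φ g')
      rw [dist_inv_one] at e1
      linarith [hrφ g hgp, hrφ' g' hgp']
    have hδ := (eventuallyConst Γ).mul_mem hβ hξ
    have hlim' := R.tendsto_limRatio_mul_tail hΓ hH hδ hkΓ k.2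
    set h := limRatio f (β * ξ) 1
    obtain ⟨L, hL⟩ := Metric.tendsto_atTop.1 (R.tendsto_limRatio hδ hβ) (τ / 4) (by positivity)
    obtain ⟨n, ⟨hn1, hn2⟩, hn3, hnI, hnJ⟩ := (((hstep _ hδ).and
      (Metric.tendsto_nhds.1 hlim' (τ / 4) (by positivity))).and
      ((R.eventually_forall_dist_le hδ L (show 0 < τ / 4 by positivity)).and
        ((eventually_ge_atTop I).and (eventually_ge_atTop J)))).exists
    have hkn := tail_mem hkΓ n
    refine ⟨ξ * tail n (k : G), (eventuallyConst Γ).mul_mem hξ hkn, ?_, ⟨g', hg'Γ', ?_, n, ?_⟩,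
      ?_, ?_⟩
    · intro i hi
      simp [hξ1 i hi, tail_of_lt (hi.trans_le hnI)]
    · linarith
    · intro j hj
      simp [hJ j (hnJ.trans hj), tail_of_le hj, hk]
    · intro l
      rw [← mul_assoc]
      have e1 := dist_triangle (f (β * ξ * tail n (k : G)) l) (f (β * ξ) l) (f β l)
      rcases lt_or_ge l L with hl | hl
      · have e2 := hn3 l hl _ (R.mem_of_mem ((eventuallyConst Γ).mul_mem hδ hkn)) fun i hi => by
          simp [tail_of_lt hi]
        linarith [hsup l]
      · have e2 := hn1 k hkΓ hkρ l
        have e3 := hL l hl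
        have e4 := dist_triangle (f (β * ξ) l * (f β l)⁻¹) (limRatio f (β * ξ) β) 1
        rw [dist_mul_inv_one] at e4
        linarith
    · rw [← mul_assoc, ← R.limRatio_mul ((eventuallyConst Γ).mul_mem hδ hkn) hδ hβ]
      have e1 := dist_mul_one_le (limRatio f (β * ξ * tail n (k : G)) (β * ξ))
        (limRatio f (β * ξ) β)
      have e2 := dist_triangle (limRatio f (β * ξ * tail n (k : G)) (β * ξ))
        (h * limHom f (k : G) * h⁻¹) 1
      rw [dist_conj_one] at e2
      linarith
  have hker : ∀ q ∈ Subgroup.closure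
      {k : Subgroup.connectedComponentOfOne G | φ k = 1 ∧ dist k 1 < ρ / 2}, φ q = 1 :=
    fun q hq => (Subgroup.closure_le φ.ker).2 (fun k hk => hk.1) hq
  induction hp using Subgroup.closure_induction_right with
  | one =>
    intro τ hτ
    refine ⟨1, (eventuallyConst Γ).one_mem, fun _ _ => rfl, ⟨1, Γ.one_mem, by simpa using hτ, 0,
      fun _ _ => rfl⟩, fun l => ?_, ?_⟩
    · rw [mul_one, dist_self]; positivity
    · rw [mul_one, R.limRatio_self hβ, dist_self]; exact hτ.le
  | mul_right x hx y hy ih => exact step x y (hker x hx) hy.1 hy.2 ih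
  | mul_inv_cancel x hx y hy ih =>
    refine step x y⁻¹ (hker x hx) (by rw [map_inv, hy.1, inv_one]) ?_ ih
    have : dist (y : G)⁻¹ 1 = dist (y : G) 1 := dist_inv_one _
    exact this.trans_lt hy.2

end GenericReduction

namespace GenericReduction

variable {G H : Type*} [Group G] [MetricSpace G] [IsTopologicalGroup G]
  [IsIsometricSMul G G] [IsIsometricSMul Gᵐᵒᵖ G]
  [Group H] [MetricSpace H] [IsTopologicalGroup H]
  [IsIsometricSMul H H] [IsIsometricSMul Hᵐᵒᵖ H]
  {Γ : Subgroup G} {f : (ℕ → G) → ℕ → H} {O : ℕ → Set (ℕ → G)}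

/-- A limit of sequences whose images converge uniformly converges in `G`. -/
theorem exists_tendsto_of_uniform [CompleteSpace H] (R : GenericReduction Γ f O)
    {β : ℕ → ℕ → G} (hβ : ∀ k, β k ∈ eventuallyConst Γ)
    (hstep : ∀ k l, dist (f (β (k + 1)) l) (f (β k) l) ≤ (1 / 2) ^ k) {w : ℕ → G}
    (hw : ∀ k, ∀ l < k, dist (f w l) (f (β (k + 1)) l) ≤ (1 / 2) ^ k) :
    ∃ g, Tendsto w atTop (𝓝 g) := by
  have h1 : ∀ k m, k ≤ m → ∀ l, dist (f (β m) l) (f (β k) l) ≤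
      2 * (1 / 2 : ℝ) ^ k - 2 * (1 / 2) ^ m := by
    intro k m hkm l
    induction m, hkm using Nat.le_induction with
    | base => simp
    | succ m hkm ih =>
      have e : (1 / 2 : ℝ) ^ (m + 1) = (1 / 2) ^ m / 2 := by ring
      rw [e]
      linarith [dist_triangle (f (β (m + 1)) l) (f (β m) l) (f (β k) l), hstep m l]
  have h2 : ∀ k l, dist (f w l) (f (β k) l) ≤ 2 * (1 / 2 : ℝ) ^ k := by
    intro k l
    have e1 := hw (max k (l + 1)) l (lt_of_lt_of_le (Nat.lt_succ_self l) (le_max_right _ _))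
    have e2 := h1 k (max k (l + 1) + 1) ((le_max_left _ _).trans (Nat.le_succ _)) l
    have e : (1 / 2 : ℝ) ^ (max k (l + 1) + 1) = (1 / 2) ^ max k (l + 1) / 2 := by ring
    rw [e] at e2
    linarith [dist_triangle (f w l) (f (β (max k (l + 1) + 1)) l) (f (β k) l)]
  -- A uniform limit of convergent sequences is Cauchy, and convergence of the ratio to `f 1` pulls
  -- back to convergence of `w`.
  have h3 : CauchySeq fun l => f w l * (f 1 l)⁻¹ := by
    refine Metric.cauchySeq_iff.2 fun ε hε => ?_
    obtain ⟨k, hk⟩ := exists_pow_lt_of_lt_one (show 0 < ε / 8 by positivity)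
      (show (1 / 2 : ℝ) < 1 by norm_num)
    obtain ⟨L, hL⟩ := Metric.cauchySeq_iff.1
      (R.tendsto_limRatio (hβ k) (eventuallyConst Γ).one_mem).cauchySeq (ε / 2) (half_pos hε)
    refine ⟨L, fun m hm n hn => ?_⟩
    have e1 := hL m hm n hn
    have e2 := dist_triangle4 (f w m * (f 1 m)⁻¹) (f (β k) m * (f 1 m)⁻¹)
      (f (β k) n * (f 1 n)⁻¹) (f w n * (f 1 n)⁻¹)
    rw [dist_mul_right, dist_mul_right, dist_comm (f (β k) n)] at e2
    linarith [h2 k m, h2 k n]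
  obtain ⟨g, hg⟩ := (R.conv_iff w 1).2 (cauchySeq_tendsto_of_complete h3)
  exact ⟨g, by simpa using hg⟩

/-- Small elements of the kernel generate a small subgroup. -/
theorem exists_forall_mem_closure_ker_dist_lt [CompleteSpace H] (R : GenericReduction Γ f O)
    (hΓ : Dense (Γ : Set G)) (hH : HasSmallNSSQuotients H)
    (hG₀ : IsOpen (Subgroup.connectedComponentOfOne G : Set G))
    {φ : Subgroup.connectedComponentOfOne G →* H} (hφ : Continuous φ)
    (hφf : ∀ g : Subgroup.connectedComponentOfOne G, (g : G) ∈ Γ → φ g = limHom f g)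
    {ε : ℝ} (hε : 0 < ε) :
    ∃ ρ > 0, ∀ p ∈ Subgroup.closure
      {k : Subgroup.connectedComponentOfOne G | φ k = 1 ∧ dist k 1 < ρ}, dist p 1 < ε := by
  by_contra! hbad
  let S := {p : (ℕ → G) × ℕ // p.1 ∈ eventuallyConst Γ ∧ ∀ j ≥ p.2, p.1 j = p.1 p.2}
  have hnext : ∀ (k : ℕ) (s : S), ∃ t : S, s.1.2 < t.1.2 ∧ (∀ i < s.1.2 + 1, t.1.1 i = s.1.1 i) ∧
      ε / 2 ≤ dist (t.1.1 t.1.2) (s.1.1 s.1.2) ∧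
      (∀ l, dist (f t.1.1 l) (f s.1.1 l) ≤ (1 / 2) ^ k) ∧
      (∀ w : ℕ → G, (∀ i < t.1.2, w i = t.1.1 i) → w ∈ O k) ∧
      (∀ l < k, ∀ w : ℕ → G, (∀ k, w ∈ O k) → (∀ i < t.1.2, w i = t.1.1 i) →
        dist (f w l) (f t.1.1 l) ≤ (1 / 2) ^ k) := by
    rintro k ⟨⟨β, M⟩, hβ, hM⟩
    change β ∈ eventuallyConst Γ at hβ
    change ∀ j ≥ M, β j = β M at hM
    have hk : (0 : ℝ) < (1 / 2) ^ k := by positivity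
    obtain ⟨ρ, hρ, h⟩ := R.exists_forall_dist_le_of_mem_closure_ker hΓ hH hG₀ hφ hφf (half_pos hk)
    obtain ⟨p, hp, hpε⟩ := hbad ρ hρ
    -- With `M + 1` in place of `M` the limit sequence takes the final value of `β` at the index
    -- `M`; these values jump by at least `ε / 2` at every stage.
    obtain ⟨ξ, hξ, hξ1, ⟨g, -, hgp, J, hJ⟩, hsup, -⟩ := h p hp β hβ (M + 1)
      (min ((1 / 2) ^ k / 2) (ε / 2)) (by positivity)
    have hβξ := (eventuallyConst Γ).mul_mem hβ hξ
    obtain ⟨M', hM'1, hM'2, hM'M, hM'J⟩ := ((R.eventually_mem hβξ k).and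
      ((R.eventually_forall_dist_le hβξ k hk).and
        ((eventually_gt_atTop M).and (eventually_ge_atTop J)))).exists
    have hval : ∀ j ≥ M', (β * ξ) j = β M * g := fun j hj => by
      rw [Pi.mul_apply, hM j (hM'M.le.trans hj), hJ j (hM'J.trans hj)]
    refine ⟨⟨⟨β * ξ, M'⟩, hβξ, fun j hj => ?_⟩, hM'M, fun i hi => ?_, ?_, fun l => ?_, hM'1, hM'2⟩
    · change (β * ξ) j = (β * ξ) M'
      rw [hval j hj, hval M' le_rfl]
    · simp [hξ1 i hi]
    · change ε / 2 ≤ dist ((β * ξ) M') (β M)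
      rw [hval M' le_rfl]
      have e1 := dist_mul_left (β M) (g : G) 1
      rw [mul_one] at e1
      rw [e1]
      have e2 : dist p 1 ≤ dist p g + dist (g : G) 1 := dist_triangle p g 1
      rw [dist_comm p g] at e2
      linarith [min_le_right ((1 / 2 : ℝ) ^ k / 2) (ε / 2)]
    · refine (hsup l).trans ?_
      linarith [min_le_left ((1 / 2 : ℝ) ^ k / 2) (ε / 2)]
  choose next h1 h2 h3 h4 h5 h6 using hnext
  let s : ℕ → S := fun k => Nat.rec ⟨⟨1, 0⟩, (eventuallyConst Γ).one_mem, fun _ _ => rfl⟩ next k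
  have hM : StrictMono fun k => (s k).1.2 + 1 :=
    strictMono_nat_of_lt_succ fun k => Nat.succ_lt_succ (h1 k (s k))
  obtain ⟨w, hw⟩ := exists_forall_lt_eq (fun k => (s k).1.1) _ hM fun k => h2 k (s k)
  have hw' : ∀ k, ∀ i < (s k).1.2, w i = (s k).1.1 i := fun k i hi =>
    hw k i (hi.trans (Nat.lt_succ_self _))
  have hwO : ∀ k, w ∈ O k := fun k => h5 k (s k) w (hw' (k + 1))
  obtain ⟨g, hg⟩ := R.exists_tendsto_of_uniform (β := fun k => (s k).1.1) (fun k => (s k).2.1)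
    (fun k l => h4 k (s k) l) (fun k l hl => h6 k (s k) l hl w hwO (hw' (k + 1)))
  obtain ⟨n, hn⟩ := Metric.tendsto_atTop.1 hg (ε / 4) (by positivity)
  have hMn : ∀ k, n ≤ k → n ≤ (s k).1.2 := fun k hk =>
    hk.trans ((strictMono_nat_of_lt_succ (f := fun k => (s k).1.2) fun k => h1 k (s k)).le_apply)
  have e1 := hn _ (hMn n le_rfl)
  have e2 := hn _ (hMn (n + 1) (Nat.le_succ n))
  rw [hw n _ (Nat.lt_succ_self _)] at e1
  rw [hw (n + 1) _ (Nat.lt_succ_self _)] at e2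
  have e3 := h3 n (s n)
  have e4 := dist_triangle_right ((s (n + 1)).1.1 (s (n + 1)).1.2) ((s n).1.1 (s n).1.2) g
  change ε / 2 ≤ dist ((s (n + 1)).1.1 (s (n + 1)).1.2) ((s n).1.1 (s n).1.2) at e3
  linarith

theorem nonarchimedeanGroup_ker [CompleteSpace H] (R : GenericReduction Γ f O)
    (hΓ : Dense (Γ : Set G)) (hH : HasSmallNSSQuotients H)
    (hG₀ : IsOpen (Subgroup.connectedComponentOfOne G : Set G))
    {φ : Subgroup.connectedComponentOfOne G →* H} (hφ : Continuous φ)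
    (hφf : ∀ g : Subgroup.connectedComponentOfOne G, (g : G) ∈ Γ → φ g = limHom f g) :
    NonarchimedeanGroup φ.ker where
  is_nonarchimedean U hU := by
    obtain ⟨ε, hε, hεU⟩ := Metric.mem_nhds_iff.1 hU
    obtain ⟨ρ, hρ, h⟩ := R.exists_forall_mem_closure_ker_dist_lt hΓ hH hG₀ hφ hφf hε
    let S := (Subgroup.closure
      {k : Subgroup.connectedComponentOfOne G | φ k = 1 ∧ dist k 1 < ρ}).subgroupOf φ.ker
    have hS : IsOpen (S : Set φ.ker) :=
      S.isOpen_of_mem_nhds (mem_of_superset (Metric.ball_mem_nhds 1 hρ) fun x hx =>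
        Subgroup.subset_closure ⟨x.2, hx⟩)
    exact ⟨⟨S, hS⟩, fun x hx => hεU (h x hx)⟩

/-! ### Conjugation by arbitrary elements and the theorem -/

/-- Every conjugation of the identity component is intertwined with a limit of conjugations. -/
theorem exists_tendsto_conj [CompleteSpace H] [Countable Γ] (R : GenericReduction Γ f O)
    (hΓ : Dense (Γ : Set G)) (hH : HasSmallNSSQuotients H)
    (hG₀ : IsOpen (Subgroup.connectedComponentOfOne G : Set G))
    {φ : Subgroup.connectedComponentOfOne G →* H} (hφ : Continuous φ)
    (hφf : ∀ g : Subgroup.connectedComponentOfOne G, (g : G) ∈ Γ → φ g = limHom f g) (u : G) :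
    ∃ h : ℕ → H, ∀ g : Subgroup.connectedComponentOfOne G,
      Tendsto (fun n => h n * φ g * (h n)⁻¹) atTop (𝓝 (φ (MulAut.conjNormal u g))) := by
  have hconj : ∀ g : Subgroup.connectedComponentOfOne G,
      Continuous fun v : G => φ (MulAut.conjNormal v g) := fun g =>
    hφ.comp (Continuous.subtype_mk (f := fun v : G => v * g * v⁻¹) (by fun_prop) _)
  have hconj' : Continuous fun g : Subgroup.connectedComponentOfOne G =>
      φ (MulAut.conjNormal u g) :=
    hφ.comp (Continuous.subtype_mk
      (f := fun g : Subgroup.connectedComponentOfOne G => u * g * u⁻¹) (by fun_prop) _)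
  have hcount : Countable (Γ.subgroupOf (Subgroup.connectedComponentOfOne G)) :=
    Function.Injective.countable (β := Γ) (f := fun x => ⟨x.1.1, x.2⟩) fun x y hxy =>
      Subtype.ext (Subtype.ext (congrArg (fun z : Γ => (z : G)) hxy))
  obtain ⟨γ, hγ⟩ := exists_surjective_nat (Γ.subgroupOf (Subgroup.connectedComponentOfOne G))
  -- At finitely many points of the dense subgroup `u` may be replaced by a nearby `v` in `Γ`; a
  -- diagonal choice then covers all points of the enumeration.
  have hex : ∀ n : ℕ, ∃ h : H, ∀ i < n,
      dist (h * φ (γ i) * h⁻¹) (φ (MulAut.conjNormal u (γ i).1)) < 1 / ((n : ℝ) + 1) := by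
    intro n
    have hpos : (0 : ℝ) < 1 / ((n : ℝ) + 1) / 2 := by positivity
    have hnhds : ∀ᶠ v in 𝓝 u, ∀ i < n, dist (φ (MulAut.conjNormal v (γ i).1))
        (φ (MulAut.conjNormal u (γ i).1)) < 1 / ((n : ℝ) + 1) / 2 :=
      (eventually_all_finite (Set.finite_lt_nat n)).2 fun i _ =>
        Metric.tendsto_nhds.1 (hconj (γ i).1).continuousAt _ hpos
    obtain ⟨v, hv, hvΓ⟩ := mem_closure_iff_nhds.1 (hΓ u) _ hnhds
    obtain ⟨h, hh⟩ := R.exists_tendsto_conj_limHom hΓ hH hvΓ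
    have hev : ∀ᶠ m in atTop, ∀ i < n, dist (h m * φ (γ i) * (h m)⁻¹)
        (φ (MulAut.conjNormal v (γ i).1)) < 1 / ((n : ℝ) + 1) / 2 := by
      refine (eventually_all_finite (Set.finite_lt_nat n)).2 fun i _ => ?_
      have h1 : ((γ i).1 : G) ∈ Γ := (γ i).2
      rw [hφf _ h1, hφf (MulAut.conjNormal v (γ i).1)
        (Γ.mul_mem (Γ.mul_mem hvΓ h1) (Γ.inv_mem hvΓ))]
      exact Metric.tendsto_nhds.1 (hh _ h1 (γ i).1.2) _ hpos
    obtain ⟨m, hm⟩ := hev.exists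
    refine ⟨h m, fun i hi => ?_⟩
    have e1 := hm i hi
    have e2 : dist (φ (MulAut.conjNormal v (γ i).1)) (φ (MulAut.conjNormal u (γ i).1)) <
      1 / ((n : ℝ) + 1) / 2 := hv i hi
    linarith [dist_triangle (h m * φ (γ i) * (h m)⁻¹) (φ (MulAut.conjNormal v (γ i).1))
      (φ (MulAut.conjNormal u (γ i).1))]
  choose h hh using hex
  -- Conjugations in `H` are isometries, so convergence on a dense set passes to every `g`.
  refine ⟨h, fun g => Metric.tendsto_nhds.2 fun ε hε => ?_⟩
  have hε3 : 0 < ε / 3 := by positivity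
  obtain ⟨x, ⟨hx1, hx2⟩, hxΓ⟩ := mem_closure_iff_nhds.1
    (dense_subgroupOf_connectedComponentOfOne hΓ hG₀ g) _
    (inter_mem (Metric.tendsto_nhds.1 hφ.continuousAt _ hε3)
      (Metric.tendsto_nhds.1 hconj'.continuousAt _ hε3))
  obtain ⟨i, hi⟩ := hγ ⟨x, hxΓ⟩
  obtain ⟨N, hN⟩ := exists_nat_one_div_lt hε3
  filter_upwards [eventually_gt_atTop i, eventually_ge_atTop N] with n hni hnN
  have e1 := hh n i hni
  rw [hi] at e1
  have e2 : 1 / ((n : ℝ) + 1) ≤ 1 / ((N : ℝ) + 1) := by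
    have : (N : ℝ) ≤ n := by exact_mod_cast hnN
    gcongr
  have e3 : dist (φ x) (φ g) < ε / 3 := hx1
  have e4 : dist (φ (MulAut.conjNormal u x)) (φ (MulAut.conjNormal u g)) < ε / 3 := hx2
  have e5 := dist_triangle4 (h n * φ g * (h n)⁻¹) (h n * φ x * (h n)⁻¹)
    (φ (MulAut.conjNormal u x)) (φ (MulAut.conjNormal u g))
  rw [dist_conj, dist_comm (φ g)] at e5
  linarith

end GenericReduction

theorem theorem3p7
    {G H : Type*}
    [Group G] [TopologicalSpace G] [IsTopologicalGroup G] [PolishSpace G]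
    [Group H] [TopologicalSpace H] [IsTopologicalGroup H] [PolishSpace H]
    (hG : IsTSI G) (hG₀ : IsOpen (Subgroup.connectedComponentOfOne G : Set G))
    (hH : IsTSI H) (hHpl : IsProLie H)
    (hred : BorelReducible (seqEquiv G) (seqEquiv H)) :
    ∃ (φ : Subgroup.connectedComponentOfOne G →* H)
      (hφ : ∀ g, φ g ∈ Subgroup.connectedComponentOfOne H),
      Continuous φ ∧
      NonarchimedeanGroup φ.ker ∧
      -- `φ Inn_G(G₀)` lies in the closure of `Inn_H(H₀) φ` in the product topology on `H ^ G₀`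
      {f : Subgroup.connectedComponentOfOne G → H |
          ∃ ι ∈ innOn G (Subgroup.connectedComponentOfOne G), f = fun g => φ (ι g)} ⊆
        closure {f : Subgroup.connectedComponentOfOne G → H |
          ∃ κ ∈ innOn H (Subgroup.connectedComponentOfOne H),
            f = fun g => (κ ⟨φ g, hφ g⟩ : H)} ∧
      -- the same inclusion, in terms of sequences
      ∀ u : G, ∃ h : ℕ → H, ∀ g : Subgroup.connectedComponentOfOne G,
        Tendsto (fun n => h n * φ g * (h n)⁻¹) atTop (𝓝 (φ (MulAut.conjNormal u g))) := by
  obtain ⟨mG, rfl, hGl, hGr⟩ := hG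
  obtain ⟨mH, rfl, hHl, hHr⟩ := hH
  have : IsIsometricSMul G G := ⟨fun c => Isometry.of_dist_eq fun a b => hGl a b c⟩
  have : IsIsometricSMul Gᵐᵒᵖ G := ⟨fun c => Isometry.of_dist_eq fun a b => hGr a b c.unop⟩
  have : IsIsometricSMul H H := ⟨fun c => Isometry.of_dist_eq fun a b => hHl a b c⟩
  have : IsIsometricSMul Hᵐᵒᵖ H := ⟨fun c => Isometry.of_dist_eq fun a b => hHr a b c.unop⟩
  have : CompleteSpace H := completeSpace_of_isIsometricSMul H
  have hNSS := hHpl.hasSmallNSSQuotients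
  obtain ⟨Γ, hΓc, hΓ⟩ := exists_countable_dense_subgroup G
  obtain ⟨f, O, R⟩ := exists_genericReduction Γ hred
  obtain ⟨φ, hφ, hφf⟩ := R.exists_monoidHom hΓ hNSS hG₀
  have hmem : ∀ g, φ g ∈ Subgroup.connectedComponentOfOne H := by
    intro g
    have : PreconnectedSpace (Subgroup.connectedComponentOfOne G) :=
      Subtype.preconnectedSpace isPreconnected_connectedComponent
    exact (isPreconnected_range hφ).subset_connectedComponent ⟨1, map_one φ⟩ ⟨g, rfl⟩
  have hconj := R.exists_tendsto_conj hΓ hNSS hG₀ hφ hφf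
  refine ⟨φ, hmem, hφ, R.nonarchimedeanGroup_ker hΓ hNSS hG₀ hφ hφf, ?_, hconj⟩
  rintro _ ⟨_, ⟨u, rfl⟩, rfl⟩
  obtain ⟨h, hh⟩ := hconj u
  exact mem_closure_of_tendsto (tendsto_pi_nhds.2 hh)
    (Eventually.of_forall fun n => ⟨_, ⟨h n, rfl⟩, rfl⟩)
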